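/- Let $k$ be a field complete for a non-Archimedean absolute value (possibly trivial), let $n\ge 0$, $r_1,\dots,r_n>0$, and let $X$ be the open $k$-polydisc of polyradius $(r_1,\dots,r_n)$ in the sense of Berkovich. Let $\mathcal A$ be the $k$-algebra of analytic functions on $X$, that is, of the power series over $k$ in $T_1,\dots,T_n$ that converge on $X$, and let $\|a\|_\infty=\sup_{x\in X}|a(x)|\in[0,\infty]$ be the spectral norm. For $t>0$ let $\mathcal A_{\le t}=\{a:\|a\|_\infty\le t\}$ and let $\mathcal A_{\prec t}$ be the completion of $\mathcal A_{<t}=\{a:\|a\|_\infty<t\}$ for uniform convergence on compact subsets, i.e. its closure in $\mathcal A$. Put $\widetilde{\mathcal A}=\bigoplus_{t>0}\mathcal A_{\le t}/\mathcal A_{\prec t}$, a graded algebra over the graded field $\widetilde k=\bigoplus_{t>0}\{|c|\le t\}/\{|c|<t\}$. For a bounded function $a\in\mathcal A$, let $\widetilde a\in\widetilde{\mathcal A}$ be its class in degree $\|a\|_\infty$ if $\|a\|_\infty\ne 0$, and $\widetilde a=0$ if $\|a\|_\infty=0$. The graded ring $\widetilde{\mathcal A}$ has exactly one ideal $\mathfrak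 m$ that is maximal among its proper homogeneous ideals. If $f_1,\dots,f_n\in\mathcal A$ are bounded functions on $X$, the following are equivalent: (i) the $f_i$ form a coordinate system of $X$, i.e. they induce an isomorphism of $k$-analytic spaces from $X$ onto an open polydisc of $\mathbf A^{n,\mathrm{an}}_k$ (of some positive polyradius) centred at the origin; (ii) the $\widetilde{f_i}$ belong to $\mathfrak m$ and generate the ideal $\mathfrak m$; (iii) the $\widetilde{f_i}$ belong to $\mathfrak m$ and their images in $\mathfrak m/\mathfrak m^2$ form a basis of it as a graded $\widetilde k$-vector space. -/

import Mathlib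

open Filter Topology
open scoped ENNReal DirectSum

namespace VirtualPolydisc

/-! ### Graded reductions

The group of degrees is the multiplicative group of positive reals, written additively
as `Degree`, because graded rings are indexed by additive monoids in Mathlib. -/

/-- The group of degrees: positive real numbers under multiplication. -/
abbrev Degree : Type := Additive {t : ℝ // 0 < t}

/-- A positive real number, seen as a degree. -/
def Degree.mk (t : ℝ) (ht : 0 < t) : Degree := Additive.ofMul ⟨t, ht⟩

/-- The positive real number underlying a degree. -/
def Degree.val (t : Degree) : ℝ := (Additive.toMul t).1

theorem Degree.val_pos (t : Degree) : 0 < t.val := (Additive.toMul t).2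

theorem Degree.val_add (s t : Degree) : (s + t).val = s.val * t.val := rfl

theorem Degree.val_zero : (0 : Degree).val = 1 := rfl

/-- A multiplicative filtration of a commutative ring by additive subgroups `le t`
(the elements "of size at most `t`"), with distinguished subgroups `lt t`
to be divided out in degree `t`. -/
structure Filtration (A : Type*) [CommRing A] where
  le : Degree → AddSubgroup A
  lt : Degree → AddSubgroup A
  one_mem : (1 : A) ∈ le 0
  mul_mem : ∀ {s t : Degree} {a b : A}, a ∈ le s → b ∈ le t → a * b ∈ le (s + t)
  mul_mem_lt : ∀ {s t : Degree} {a b : A}, a ∈ le s → b ∈ lt t → a * b ∈ lt (s + t)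

section GradedReduction

variable {A : Type*} [CommRing A] (F : Filtration A)

/-- The homogeneous part of degree `t` of the graded reduction: `le t / lt t`. -/
abbrev Piece (t : Degree) : Type _ := F.le t ⧸ (F.lt t).addSubgroupOf (F.le t)

/-- The class in degree `t` of an element of `le t`. -/
def Piece.mk (t : Degree) (a : A) (ha : a ∈ F.le t) : Piece F t :=
  QuotientAddGroup.mk (⟨a, ha⟩ : F.le t)

variable {F}

theorem Piece.ind {t : Degree} {P : Piece F t → Prop}
    (h : ∀ (a : A) (ha : a ∈ F.le t), P (Piece.mk F t a ha)) (x : Piece F t) : P x := by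
  induction x using QuotientAddGroup.induction_on with
  | H a => exact h a.1 a.2

theorem Piece.mk_eq_mk {t : Degree} {a b : A} (ha : a ∈ F.le t) (hb : b ∈ F.le t) :
    Piece.mk F t a ha = Piece.mk F t b hb ↔ -a + b ∈ F.lt t := by
  unfold Piece.mk
  rw [QuotientAddGroup.eq]
  exact AddSubgroup.mem_addSubgroupOf

theorem Piece.mk_zero {t : Degree} : Piece.mk F t 0 (F.le t).zero_mem = 0 := rfl

theorem Piece.mk_add {t : Degree} {a b : A} (ha : a ∈ F.le t) (hb : b ∈ F.le t) :
    Piece.mk F t (a + b) ((F.le t).add_mem ha hb) = Piece.mk F t a ha + Piece.mk F t b hb := rfl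

/-- Multiplication of homogeneous parts, induced by the multiplication of the ring. -/
def Piece.mul {s t : Degree} : Piece F s → Piece F t → Piece F (s + t) :=
  Quotient.map₂
    (fun a b => (⟨a.1 * b.1, F.mul_mem a.2 b.2⟩ : F.le (s + t)))
    (by
      rintro ⟨a, ha⟩ ⟨a', ha'⟩ h ⟨b, hb⟩ ⟨b', hb'⟩ h'
      have h1 : -a + a' ∈ F.lt s := (Piece.mk_eq_mk ha ha').1 (Quotient.sound h)
      have h2 : -b + b' ∈ F.lt t := (Piece.mk_eq_mk hb hb').1 (Quotient.sound h')
      refine Quotient.exact ((Piece.mk_eq_mk (F.mul_mem ha hb) (F.mul_mem ha' hb')).2 ?_)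
      have e : -(a * b) + a' * b' = b * (-a + a') + a' * (-b + b') := by ring
      rw [e]
      refine (F.lt (s + t)).add_mem ?_ (F.mul_mem_lt ha' h2)
      rw [add_comm s t]
      exact F.mul_mem_lt hb h1)

theorem Piece.mul_mk {s t : Degree} {a b : A} (ha : a ∈ F.le s) (hb : b ∈ F.le t) :
    Piece.mul (Piece.mk F s a ha) (Piece.mk F t b hb) =
      Piece.mk F (s + t) (a * b) (F.mul_mem ha hb) := rfl

theorem Piece.mk_sigma_eq {s t : Degree} {a b : A} (ha : a ∈ F.le s) (hb : b ∈ F.le t)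
    (hst : s = t) (hab : a = b) :
    GradedMonoid.mk s (Piece.mk F s a ha) = GradedMonoid.mk t (Piece.mk F t b hb) := by
  subst hst hab
  rfl

instance : GradedMonoid.GMul (Piece F) where
  mul := Piece.mul

instance : GradedMonoid.GOne (Piece F) where
  one := Piece.mk F 0 1 F.one_mem

theorem Piece.gmul_mk {s t : Degree} {a b : A} (ha : a ∈ F.le s) (hb : b ∈ F.le t) :
    GradedMonoid.GMul.mul (Piece.mk F s a ha) (Piece.mk F t b hb) =
      Piece.mk F (s + t) (a * b) (F.mul_mem ha hb) := rfl

noncomputable instance : DirectSum.GCommRing (Piece F) where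
  mul_zero {i j} a := by
    induction a using Piece.ind with
    | h a ha => rw [← Piece.mk_zero, ← Piece.mk_zero, Piece.gmul_mk]; congr 1; simp
  zero_mul {i j} b := by
    induction b using Piece.ind with
    | h b hb => rw [← Piece.mk_zero, ← Piece.mk_zero, Piece.gmul_mk]; congr 1; simp
  mul_add {i j} a b c := by
    induction a using Piece.ind with
    | h a ha =>
    induction b using Piece.ind with
    | h b hb =>
    induction c using Piece.ind with
    | h c hc => simp only [← Piece.mk_add, Piece.gmul_mk, mul_add]
  add_mul {i j} a b c := by
    induction a using Piece.ind with
    | h a ha =>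
    induction b using Piece.ind with
    | h b hb =>
    induction c using Piece.ind with
    | h c hc => simp only [← Piece.mk_add, Piece.gmul_mk, add_mul]
  one_mul := by
    rintro ⟨i, a⟩
    induction a using Piece.ind with
    | h a ha => exact Piece.mk_sigma_eq _ _ (zero_add i) (one_mul a)
  mul_one := by
    rintro ⟨i, a⟩
    induction a using Piece.ind with
    | h a ha => exact Piece.mk_sigma_eq _ _ (add_zero i) (mul_one a)
  mul_assoc := by
    rintro ⟨i, a⟩ ⟨j, b⟩ ⟨l, c⟩
    induction a using Piece.ind with
    | h a ha =>
    induction b using Piece.ind with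
    | h b hb =>
    induction c using Piece.ind with
    | h c hc => exact Piece.mk_sigma_eq _ _ (add_assoc i j l) (mul_assoc a b c)
  mul_comm := by
    rintro ⟨i, a⟩ ⟨j, b⟩
    induction a using Piece.ind with
    | h a ha =>
    induction b using Piece.ind with
    | h b hb => exact Piece.mk_sigma_eq _ _ (add_comm i j) (mul_comm a b)
  natCast m := m • Piece.mk F 0 1 F.one_mem
  natCast_zero := zero_nsmul _
  natCast_succ m := succ_nsmul _ m
  intCast m := m • Piece.mk F 0 1 F.one_mem
  intCast_ofNat m := natCast_zsmul _ m
  intCast_negSucc_ofNat m := negSucc_zsmul _ m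

variable (F)

/-- The graded reduction `⨁ t, le t / lt t`, a commutative ring graded by `Degree`. -/
abbrev GradedReduction : Type _ := ⨁ t : Degree, Piece F t

variable {F}

/-- An ideal is homogeneous if it contains the homogeneous components of its elements. -/
def IsHomogeneousIdeal (I : Ideal (GradedReduction F)) : Prop :=
  ∀ x ∈ I, ∀ t : Degree, DirectSum.of (Piece F) t (x t) ∈ I

/-- A homogeneous ideal that is maximal among the proper homogeneous ideals.  It need not be
a maximal ideal. -/
def IsMaximalHomogeneousIdeal (I : Ideal (GradedReduction F)) : Prop :=
  Maximal (fun J : Ideal (GradedReduction F) => IsHomogeneousIdeal J ∧ J ≠ ⊤) I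

/-- The morphism in degree `t` induced by a ring morphism compatible with filtrations. -/
def Piece.map {B : Type*} [CommRing B] {G : Filtration B} (u : A →+* B)
    (hle : ∀ t, ∀ a ∈ F.le t, u a ∈ G.le t) (hlt : ∀ t, ∀ a ∈ F.lt t, u a ∈ G.lt t)
    (t : Degree) : Piece F t →+ Piece G t :=
  QuotientAddGroup.map _ _
    ((u.toAddMonoidHom.comp (F.le t).subtype).codRestrict (G.le t) fun a => hle t a.1 a.2)
    (fun a ha => hlt t a.1 ha)

/-- The morphism of graded rings induced by a ring morphism compatible with filtrations. -/
noncomputable def GradedReduction.map {B : Type*} [CommRing B] {G : Filtration B} (u : A →+* B)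
    (hle : ∀ t, ∀ a ∈ F.le t, u a ∈ G.le t) (hlt : ∀ t, ∀ a ∈ F.lt t, u a ∈ G.lt t) :
    GradedReduction F →+* GradedReduction G :=
  DirectSum.toSemiring
    (fun t => (DirectSum.of (Piece G) t).comp (Piece.map u hle hlt t))
    (by
      refine DirectSum.of_eq_of_gradedMonoid_eq ?_
      exact Piece.mk_sigma_eq (hle 0 1 F.one_mem) G.one_mem rfl (map_one u))
    (by
      intro i j a b
      induction a using Piece.ind with
      | h a ha =>
      induction b using Piece.ind with
      | h b hb =>
      simp only [AddMonoidHom.comp_apply, DirectSum.of_mul_of]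
      refine DirectSum.of_eq_of_gradedMonoid_eq ?_
      exact Piece.mk_sigma_eq (hle _ _ (F.mul_mem ha hb))
        (G.mul_mem (hle _ _ ha) (hle _ _ hb)) rfl (map_mul u a b))

end GradedReduction

/-! ### The graded residue field -/

section Polydiscs

variable (k : Type*) [NormedField k] [IsUltrametricDist k]

/-- The filtration of `k` by the closed balls `‖c‖ ≤ t` and the open balls `‖c‖ < t`. -/
def fieldFiltration : Filtration k where
  le t :=
    { carrier := {c | ‖c‖ ≤ t.val}
      zero_mem' := by simpa using t.val_pos.le
      add_mem' := fun {a b} ha hb => (IsUltrametricDist.norm_add_le_max a b).trans (max_le ha hb)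
      neg_mem' := fun {a} ha => by simpa using ha }
  lt t :=
    { carrier := {c | ‖c‖ < t.val}
      zero_mem' := by simpa using t.val_pos
      add_mem' := fun {a b} ha hb =>
        (IsUltrametricDist.norm_add_le_max a b).trans_lt (max_lt ha hb)
      neg_mem' := fun {a} ha => by simpa using ha }
  one_mem := by
    change ‖(1 : k)‖ ≤ (0 : Degree).val
    rw [norm_one, Degree.val_zero]
  mul_mem {s t a b} ha hb := by
    change ‖a * b‖ ≤ (s + t).val
    rw [norm_mul, Degree.val_add]
    exact mul_le_mul ha hb (norm_nonneg _) s.val_pos.le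
  mul_mem_lt {s t a b} ha hb := by
    change ‖a * b‖ < (s + t).val
    rw [norm_mul, Degree.val_add]
    have ha' : ‖a‖ ≤ s.val := ha
    have hb' : ‖b‖ < t.val := hb
    exact (mul_le_mul_of_nonneg_right ha' (norm_nonneg b)).trans_lt
      (mul_lt_mul_of_pos_left hb' s.val_pos)

/-- The graded residue field `⨁ t, {‖c‖ ≤ t} / {‖c‖ < t}` of `k`. -/
abbrev GradedResidueField : Type _ := GradedReduction (fieldFiltration k)

/-! ### Closed and open polydiscs and their analytic functions -/

variable {n : ℕ}

/-- `ρ` is the polyradius of a closed polydisc inside the open polydisc of polyradius `r`. -/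
def IsInnerRadius (ρ r : Fin n → ℝ) : Prop := ∀ i, 0 < ρ i ∧ ρ i < r i

/-- The Tate algebra `k{ρ⁻¹T}`: the power series `∑ a_I T^I` with `‖a_I‖ ρ^I → 0`.
This is the affinoid algebra of the closed polydisc of polyradius `ρ`. -/
noncomputable def tateAlgebra (ρ : Fin n → ℝ) : Subalgebra k (MvPowerSeries (Fin n) k) where
  carrier := {h | MvPowerSeries.IsRestricted ρ h}
  mul_mem' := MvPowerSeries.isRestricted.mul ρ
  add_mem' := MvPowerSeries.isRestricted.add ρ
  algebraMap_mem' c := MvPowerSeries.isRestricted_C ρ c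

/-- The algebra of analytic functions on the open polydisc of polyradius `r`: the power series
converging on every closed polydisc contained in it. -/
noncomputable def functions (r : Fin n → ℝ) : Subalgebra k (MvPowerSeries (Fin n) k) where
  carrier := {h | ∀ ρ, IsInnerRadius ρ r → h ∈ tateAlgebra k ρ}
  mul_mem' hf hg ρ hρ := mul_mem (hf ρ hρ) (hg ρ hρ)
  add_mem' hf hg ρ hρ := add_mem (hf ρ hρ) (hg ρ hρ)
  algebraMap_mem' c ρ _ := (tateAlgebra k ρ).algebraMap_mem c

variable {k}

/-- The `i`-th coordinate function on the open polydisc of polyradius `r`. -/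
noncomputable def coordinate (r : Fin n → ℝ) (i : Fin n) : functions k r :=
  ⟨MvPowerSeries.X i, fun ρ _ => MvPowerSeries.isRestricted_monomial ρ _ _⟩

/-- Restriction of functions from an open polydisc to a closed polydisc contained in it. -/
noncomputable def restrict {ρ r : Fin n → ℝ} (h : IsInnerRadius ρ r) :
    functions k r →ₐ[k] tateAlgebra k ρ :=
  Subalgebra.inclusion fun _ hf => hf ρ h

/-- The Gauss norm `sup_I ‖a_I‖ ρ^I`. -/
noncomputable def gauss (ρ : Fin n → ℝ) (h : MvPowerSeries (Fin n) k) : ℝ :=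
  MvPowerSeries.gaussNorm (fun c : k => ‖c‖) ρ h

variable (k)

/-- The points of the open polydisc of polyradius `r` in the sense of Berkovich.  The polydisc is
the union of the affinoid spaces `M(k{ρ⁻¹T})` for `ρ < r`, whose points are the multiplicative
seminorms bounded by the Gauss norm of polyradius `ρ`; such a seminorm is determined by its
restriction to the dense subalgebra of functions on the open polydisc.  The real number `x h` is
the absolute value of the function `h` at the point `x`. -/
structure OpenPolydisc (r : Fin n → ℝ) where
  seminorm : MulRingSeminorm (functions k r)
  nonarchimedean : ∀ f g, seminorm (f + g) ≤ max (seminorm f) (seminorm g)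
  bounded : ∃ ρ, IsInnerRadius ρ r ∧
    ∀ h : functions k r, seminorm h ≤ gauss ρ (h : MvPowerSeries (Fin n) k)

variable {k}

noncomputable instance (r : Fin n → ℝ) : CoeFun (OpenPolydisc k r) (fun _ => functions k r → ℝ) where
  coe x := x.seminorm

/-- The topology of the polydisc: the coarsest one for which all absolute values of functions
are continuous. -/
noncomputable instance (r : Fin n → ℝ) : TopologicalSpace (OpenPolydisc k r) :=
  TopologicalSpace.induced (fun (x : OpenPolydisc k r) (h : functions k r) => x h) inferInstance

variable (k)

/-- The points of the closed polydisc of polyradius `ρ` inside the open one of polyradius `r`. -/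
def closedPolydisc (r ρ : Fin n → ℝ) : Set (OpenPolydisc k r) :=
  {x | ∀ h : functions k r, x h ≤ gauss ρ (h : MvPowerSeries (Fin n) k)}

/-- A morphism of `k`-analytic spaces from the open polydisc of polyradius `r` to the one of
polyradius `s`, each of them being described by its atlas of closed polydiscs: a continuous map
on points together with a pullback of functions, compatible with the absolute values, such that
each closed polydisc of the source is sent into one of the target by a morphism of affinoid
spaces, that is, one given by a bounded morphism of affinoid algebras. -/
structure PolydiscHom (r s : Fin n → ℝ) where
  toFun : OpenPolydisc k r → OpenPolydisc k s
  continuous_toFun : Continuous toFun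
  pullback : functions k s →ₐ[k] functions k r
  abs_pullback : ∀ (x : OpenPolydisc k r) (h : functions k s), x (pullback h) = toFun x h
  chart : ∀ (ρ : Fin n → ℝ) (hρ : IsInnerRadius ρ r), ∃ (σ : Fin n → ℝ) (hσ : IsInnerRadius σ s),
    Set.MapsTo toFun (closedPolydisc k r ρ) (closedPolydisc k s σ) ∧
    ∃ α : tateAlgebra k σ →ₐ[k] tateAlgebra k ρ,
      (∃ C : ℝ, ∀ h : tateAlgebra k σ,
        gauss ρ (α h : MvPowerSeries (Fin n) k) ≤ C * gauss σ (h : MvPowerSeries (Fin n) k)) ∧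
      ∀ h : functions k s, α (restrict hσ h) = restrict hρ (pullback h)

variable {k}

/-- A morphism of open polydiscs is an isomorphism if it has a two-sided inverse. -/
def PolydiscHom.IsIso {r s : Fin n → ℝ} (φ : PolydiscHom k r s) : Prop :=
  ∃ ψ : PolydiscHom k s r,
    Function.LeftInverse ψ.toFun φ.toFun ∧ Function.RightInverse ψ.toFun φ.toFun ∧
    φ.pullback.comp ψ.pullback = AlgHom.id k (functions k r) ∧
    ψ.pullback.comp φ.pullback = AlgHom.id k (functions k s)

/-- The functions `f i` form a coordinate system: they induce an isomorphism from the open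
polydisc of polyradius `r` onto an open polydisc of affine `n`-space centred at the origin. -/
def IsCoordinateSystem {r : Fin n → ℝ} (f : Fin n → functions k r) : Prop :=
  ∃ s : Fin n → ℝ, (∀ i, 0 < s i) ∧
    ∃ φ : PolydiscHom k r s, φ.IsIso ∧ ∀ i, φ.pullback (coordinate s i) = f i

/-! ### The graded reduction of the algebra of functions on an open polydisc -/

/-- The spectral norm `sup_x |h(x)|` over all points, possibly infinite. -/
noncomputable def supNorm {r : Fin n → ℝ} (h : functions k r) : ℝ≥0∞ :=
  ⨆ x : OpenPolydisc k r, ENNReal.ofReal (x h)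

/-- The functions of the set `S` can approximate `h` uniformly on every compact subset. -/
def InCompactClosure {r : Fin n → ℝ} (S : Set (functions k r)) (h : functions k r) : Prop :=
  ∀ K : Set (OpenPolydisc k r), IsCompact K → ∀ ε : ℝ, 0 < ε → ∃ g ∈ S, ∀ x ∈ K, x (h - g) ≤ ε

theorem supNorm_zero {r : Fin n → ℝ} : supNorm (0 : functions k r) = 0 := by
  simp [supNorm]

theorem supNorm_neg {r : Fin n → ℝ} (f : functions k r) : supNorm (-f) = supNorm f := by
  simp [supNorm, map_neg_eq_map]

theorem supNorm_add_le {r : Fin n → ℝ} (f g : functions k r) :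
    supNorm (f + g) ≤ max (supNorm f) (supNorm g) := by
  refine iSup_le fun x => ?_
  refine (ENNReal.ofReal_le_ofReal (x.nonarchimedean f g)).trans ?_
  rw [ENNReal.ofReal_max]
  exact max_le_max (le_iSup (fun x : OpenPolydisc k r => ENNReal.ofReal (x f)) x)
    (le_iSup (fun x : OpenPolydisc k r => ENNReal.ofReal (x g)) x)

theorem supNorm_mul_le {r : Fin n → ℝ} (f g : functions k r) :
    supNorm (f * g) ≤ supNorm f * supNorm g := by
  refine iSup_le fun x => ?_
  rw [map_mul, ENNReal.ofReal_mul (apply_nonneg x.seminorm f)]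
  exact mul_le_mul' (le_iSup (fun x : OpenPolydisc k r => ENNReal.ofReal (x f)) x)
    (le_iSup (fun x : OpenPolydisc k r => ENNReal.ofReal (x g)) x)

theorem supNorm_one_le {r : Fin n → ℝ} : supNorm (1 : functions k r) ≤ 1 := by
  refine iSup_le fun x => ?_
  simp

theorem gauss_C_le (ρ : Fin n → ℝ) (c : k) :
    gauss ρ (MvPowerSeries.C c : MvPowerSeries (Fin n) k) ≤ ‖c‖ := by
  classical
  refine ciSup_le fun t => ?_
  rw [MvPowerSeries.coeff_C]
  split_ifs with ht
  · simp [ht]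
  · simp

theorem supNorm_algebraMap_le {r : Fin n → ℝ} (c : k) :
    supNorm (algebraMap k (functions k r) c) ≤ ENNReal.ofReal ‖c‖ := by
  refine iSup_le fun x => ENNReal.ofReal_le_ofReal ?_
  obtain ⟨ρ, -, hx⟩ := x.bounded
  exact (hx _).trans (gauss_C_le ρ c)

theorem inCompactClosure_of_mem {r : Fin n → ℝ} {S : Set (functions k r)} {h : functions k r}
    (hS : h ∈ S) : InCompactClosure S h :=
  fun _ _ ε hε => ⟨h, hS, fun x _ => by simpa using hε.le⟩

theorem le_of_supNorm_le {r : Fin n → ℝ} {f : functions k r} {t : ℝ} (ht : 0 ≤ t)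
    (hf : supNorm f ≤ ENNReal.ofReal t) (x : OpenPolydisc k r) : x f ≤ t :=
  (ENNReal.ofReal_le_ofReal_iff ht).1
    ((le_iSup (fun x : OpenPolydisc k r => ENNReal.ofReal (x f)) x).trans hf)

variable (k)

/-- The filtration of the algebra of functions on the open polydisc of polyradius `r`: in degree
`t` the functions of spectral norm at most `t`, and, to be divided out, the completion of the group
of functions of spectral norm less than `t` for uniform convergence on compact subsets, that is,
its closure in the (complete) algebra of functions. -/
def functionFiltration (r : Fin n → ℝ) : Filtration (functions k r) where
  le t :=
    { carrier := {h | supNorm h ≤ ENNReal.ofReal t.val}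
      zero_mem' := by simp [supNorm_zero]
      add_mem' := fun {a b} ha hb => (supNorm_add_le a b).trans (max_le ha hb)
      neg_mem' := fun {a} ha => by simpa [supNorm_neg] using ha }
  lt t :=
    { carrier := {h | InCompactClosure {g : functions k r | supNorm g < ENNReal.ofReal t.val} h}
      zero_mem' := inCompactClosure_of_mem (by simpa [supNorm_zero] using t.val_pos)
      add_mem' := fun {a b} ha hb K hK ε hε => by
        obtain ⟨a', ha', hKa⟩ := ha K hK ε hε
        obtain ⟨b', hb', hKb⟩ := hb K hK ε hε
        refine ⟨a' + b', (supNorm_add_le a' b').trans_lt (max_lt ha' hb'), fun x hx => ?_⟩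
        rw [add_sub_add_comm]
        exact (x.nonarchimedean _ _).trans (max_le (hKa x hx) (hKb x hx))
      neg_mem' := fun {a} ha K hK ε hε => by
        obtain ⟨a', ha', hKa⟩ := ha K hK ε hε
        refine ⟨-a', (supNorm_neg a').trans_lt ha', fun x hx => ?_⟩
        rw [neg_sub_neg, map_sub_rev x.seminorm]
        exact hKa x hx }
  one_mem := by
    change supNorm (1 : functions k r) ≤ ENNReal.ofReal (0 : Degree).val
    rw [Degree.val_zero, ENNReal.ofReal_one]
    exact supNorm_one_le
  mul_mem {s t a b} ha hb := by
    change supNorm (a * b) ≤ ENNReal.ofReal (s + t).val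
    rw [Degree.val_add, ENNReal.ofReal_mul s.val_pos.le]
    exact (supNorm_mul_le a b).trans (mul_le_mul' ha hb)
  mul_mem_lt {s t a b} ha hb := fun K hK ε hε => by
    obtain ⟨b', hb', hKb⟩ := hb K hK (ε / s.val) (div_pos hε s.val_pos)
    have ha' : supNorm a ≤ ENNReal.ofReal s.val := ha
    refine ⟨a * b', ?_, fun x hx => ?_⟩
    · change supNorm (a * b') < ENNReal.ofReal (s + t).val
      rw [Degree.val_add, ENNReal.ofReal_mul s.val_pos.le]
      refine ((supNorm_mul_le a b').trans (mul_le_mul_left ha' _)).trans_lt ?_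
      exact ENNReal.mul_lt_mul_right (by simpa using s.val_pos) ENNReal.ofReal_ne_top hb'
    · rw [← mul_sub, map_mul]
      refine (mul_le_mul (le_of_supNorm_le s.val_pos.le ha' x) (hKb x hx)
        (apply_nonneg x.seminorm _) s.val_pos.le).trans ?_
      rw [mul_div_cancel₀ _ s.val_pos.ne']

/-- The graded reduction of the algebra of functions on the open polydisc of polyradius `r`. -/
abbrev FunctionReduction (r : Fin n → ℝ) : Type _ := GradedReduction (functionFiltration k r)

theorem algebraMap_mem_le (r : Fin n → ℝ) (t : Degree) (c : k) (hc : c ∈ (fieldFiltration k).le t) :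
    algebraMap k (functions k r) c ∈ (functionFiltration k r).le t :=
  (supNorm_algebraMap_le c).trans (ENNReal.ofReal_le_ofReal (show ‖c‖ ≤ t.val from hc))

theorem algebraMap_mem_lt (r : Fin n → ℝ) (t : Degree) (c : k) (hc : c ∈ (fieldFiltration k).lt t) :
    algebraMap k (functions k r) c ∈ (functionFiltration k r).lt t :=
  inCompactClosure_of_mem <| (supNorm_algebraMap_le c).trans_lt
    ((ENNReal.ofReal_lt_ofReal_iff t.val_pos).2 (show ‖c‖ < t.val from hc))

/-- The graded reduction of the algebra of functions is a graded algebra over the graded residue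
field. -/
noncomputable instance (r : Fin n → ℝ) : Algebra (GradedResidueField k) (FunctionReduction k r) :=
  RingHom.toAlgebra <|
    GradedReduction.map (algebraMap k (functions k r)) (algebraMap_mem_le k r)
      (algebraMap_mem_lt k r)

variable {k}

theorem mem_le_supNorm {r : Fin n → ℝ} (h : functions k r) (ht : 0 < (supNorm h).toReal) :
    h ∈ (functionFiltration k r).le (Degree.mk (supNorm h).toReal ht) :=
  show supNorm h ≤ ENNReal.ofReal (supNorm h).toReal from
    (ENNReal.ofReal_toReal (ENNReal.toReal_pos_iff.1 ht).2.ne).ge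

/-- The graded reduction of a bounded function `h`: its class in the degree equal to its spectral
norm, or `0` if the spectral norm is `0`. -/
noncomputable def reduction {r : Fin n → ℝ} (h : functions k r) : FunctionReduction k r :=
  if ht : 0 < (supNorm h).toReal then
    DirectSum.of (Piece (functionFiltration k r)) (Degree.mk (supNorm h).toReal ht)
      (Piece.mk (functionFiltration k r) (Degree.mk (supNorm h).toReal ht) h (mem_le_supNorm h ht))
  else 0

end Polydiscs

end VirtualPolydisc

set_option linter.unusedSectionVars false

namespace VirtualPolydisc

/-! ### Weights of multi-indices -/

section Weight

variable {n : ℕ}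

/-- The value `ρ ^ I` of a monomial at a polyradius. -/
noncomputable def weight (ρ : Fin n → ℝ) (I : Fin n →₀ ℕ) : ℝ := I.prod (ρ · ^ ·)

theorem weight_eq_prod (ρ : Fin n → ℝ) (I : Fin n →₀ ℕ) : weight ρ I = ∏ i, ρ i ^ I i :=
  Finsupp.prod_fintype _ _ fun _ => pow_zero _

theorem weight_pos {ρ : Fin n → ℝ} (hρ : ∀ i, 0 < ρ i) (I : Fin n →₀ ℕ) : 0 < weight ρ I := by
  rw [weight_eq_prod]
  exact Finset.prod_pos fun i _ => pow_pos (hρ i) _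

@[simp] theorem weight_zero (ρ : Fin n → ℝ) : weight ρ 0 = 1 := by simp [weight_eq_prod]

theorem weight_add (ρ : Fin n → ℝ) (I J : Fin n →₀ ℕ) :
    weight ρ (I + J) = weight ρ I * weight ρ J := by
  simp [weight_eq_prod, pow_add, Finset.prod_mul_distrib]

@[simp] theorem weight_single (ρ : Fin n → ℝ) (i : Fin n) :
    weight ρ (Finsupp.single i 1) = ρ i := by
  simp [weight, Finsupp.prod_single_index]

theorem weight_mono {ρ ρ' : Fin n → ℝ} (hρ : ∀ i, 0 ≤ ρ i) (h : ∀ i, ρ i ≤ ρ' i)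
    (I : Fin n →₀ ℕ) : weight ρ I ≤ weight ρ' I := by
  simp only [weight_eq_prod]
  exact Finset.prod_le_prod (fun i _ => pow_nonneg (hρ i) _)
    fun i _ => pow_le_pow_left₀ (hρ i) (h i) _

theorem weight_smul (c : ℝ) (ρ : Fin n → ℝ) (I : Fin n →₀ ℕ) :
    weight (fun i => c * ρ i) I = c ^ I.degree * weight ρ I := by
  simp [weight_eq_prod, mul_pow, Finset.prod_mul_distrib, Finset.prod_pow_eq_pow_sum,
    Finsupp.degree_eq_sum]

theorem finite_degree_le (N : ℕ) : {I : Fin n →₀ ℕ | I.degree ≤ N}.Finite :=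
  Finsupp.finite_of_degree_le N

theorem tendsto_pow_degree {c : ℝ} (h0 : 0 ≤ c) (h1 : c < 1) :
    Tendsto (fun I : Fin n →₀ ℕ => c ^ I.degree) cofinite (𝓝 0) := by
  refine (tendsto_pow_atTop_nhds_zero_of_lt_one h0 h1).comp ?_
  rw [tendsto_atTop]
  intro N
  refine ((finite_degree_le N).subset fun I hI => ?_ :
    {I : Fin n →₀ ℕ | ¬ N ≤ I.degree}.Finite)
  exact (not_le.1 hI).le

end Weight

/-! ### Gauss norms -/

section Gauss

variable {k : Type*} [NormedField k] [IsUltrametricDist k] {n : ℕ} {ρ : Fin n → ℝ}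

theorem mem_tateAlgebra {h : MvPowerSeries (Fin n) k} :
    h ∈ tateAlgebra k ρ ↔
      Tendsto (fun I => ‖MvPowerSeries.coeff I h‖ * weight ρ I) cofinite (𝓝 0) := Iff.rfl

theorem gauss_eq_iSup (h : MvPowerSeries (Fin n) k) :
    gauss ρ h = ⨆ I, ‖MvPowerSeries.coeff I h‖ * weight ρ I := rfl

theorem hasGaussNorm {h : MvPowerSeries (Fin n) k} (hh : h ∈ tateAlgebra k ρ) :
    MvPowerSeries.HasGaussNorm (fun c : k => ‖c‖) ρ h := by
  have := hh.eventually (eventually_le_nhds (zero_lt_one (α := ℝ)))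
  rw [eventually_cofinite] at this
  obtain ⟨C, hC⟩ := (this.image fun I => ‖MvPowerSeries.coeff I h‖ * weight ρ I).bddAbove
  refine ⟨max C 1, ?_⟩
  rintro _ ⟨I, rfl⟩
  by_cases hI : ‖MvPowerSeries.coeff I h‖ * weight ρ I ≤ 1
  · exact hI.trans (le_max_right _ _)
  · exact (hC ⟨I, hI, rfl⟩).trans (le_max_left _ _)

theorem gauss_nonneg (h : MvPowerSeries (Fin n) k) : 0 ≤ gauss ρ h :=
  MvPowerSeries.gaussNorm_nonneg _ _ _ fun _ => norm_nonneg _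

theorem le_gauss {h : MvPowerSeries (Fin n) k} (hh : h ∈ tateAlgebra k ρ) (I : Fin n →₀ ℕ) :
    ‖MvPowerSeries.coeff I h‖ * weight ρ I ≤ gauss ρ h :=
  le_ciSup (hasGaussNorm hh) I

theorem gauss_le {h : MvPowerSeries (Fin n) k} {t : ℝ}
    (H : ∀ I, ‖MvPowerSeries.coeff I h‖ * weight ρ I ≤ t) : gauss ρ h ≤ t := ciSup_le H

theorem gauss_zero : gauss ρ (0 : MvPowerSeries (Fin n) k) = 0 := by
  simp [gauss_eq_iSup]

theorem gauss_neg (h : MvPowerSeries (Fin n) k) : gauss ρ (-h) = gauss ρ h := by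
  simp [gauss_eq_iSup]

theorem gauss_add_le (hρ : ∀ i, 0 < ρ i) {f g : MvPowerSeries (Fin n) k}
    (hf : f ∈ tateAlgebra k ρ) (hg : g ∈ tateAlgebra k ρ) :
    gauss ρ (f + g) ≤ max (gauss ρ f) (gauss ρ g) :=
  MvPowerSeries.gaussNorm_add_le_max _ _ _ _ (fun i => (hρ i).le) (fun _ => norm_nonneg _)
    IsUltrametricDist.norm_add_le_max (hasGaussNorm hf) (hasGaussNorm hg)

theorem gauss_sub_le (hρ : ∀ i, 0 < ρ i) {f g : MvPowerSeries (Fin n) k}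
    (hf : f ∈ tateAlgebra k ρ) (hg : g ∈ tateAlgebra k ρ) :
    gauss ρ (f - g) ≤ max (gauss ρ f) (gauss ρ g) := by
  rw [sub_eq_add_neg, ← gauss_neg g]
  exact gauss_add_le hρ hf (neg_mem hg)

theorem gauss_sum_le (hρ : ∀ i, 0 < ρ i) {ι : Type*} (F : Finset ι)
    {u : ι → MvPowerSeries (Fin n) k} (hu : ∀ i ∈ F, u i ∈ tateAlgebra k ρ) {t : ℝ} (ht : 0 ≤ t)
    (H : ∀ i ∈ F, gauss ρ (u i) ≤ t) : gauss ρ (∑ i ∈ F, u i) ≤ t := by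
  classical
  induction F using Finset.induction_on with
  | empty => simpa [gauss_zero] using ht
  | insert a F ha ih =>
    rw [Finset.sum_insert ha]
    refine (gauss_add_le hρ (hu a (by simp)) (sum_mem fun i hi => hu i (by simp [hi]))).trans ?_
    exact max_le (H a (by simp)) (ih (fun i hi => hu i (by simp [hi])) fun i hi => H i (by simp [hi]))

theorem gauss_eq_zero (hρ : ∀ i, 0 < ρ i) {f : MvPowerSeries (Fin n) k}
    (hf : f ∈ tateAlgebra k ρ) : gauss ρ f = 0 ↔ f = 0 :=
  MvPowerSeries.gaussNorm_eq_zero_iff _ _ _ norm_zero (fun _ => norm_nonneg _)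
    (fun _ => norm_eq_zero.1) hρ (hasGaussNorm hf)

theorem finite_lt_coeff {f : MvPowerSeries (Fin n) k} (hf : f ∈ tateAlgebra k ρ) {ε : ℝ}
    (hε : 0 < ε) : {I | ε < ‖MvPowerSeries.coeff I f‖ * weight ρ I}.Finite := by
  have := hf.eventually (eventually_le_nhds hε)
  rw [eventually_cofinite] at this
  exact this.subset fun I hI => not_le.2 hI

theorem exists_gauss_eq (hρ : ∀ i, 0 < ρ i) {f : MvPowerSeries (Fin n) k}
    (hf : f ∈ tateAlgebra k ρ) (h0 : f ≠ 0) :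
    ∃ F : Finset (Fin n →₀ ℕ), F.Nonempty ∧
      ∀ I, I ∈ F ↔ ‖MvPowerSeries.coeff I f‖ * weight ρ I = gauss ρ f := by
  have hpos : 0 < gauss ρ f := lt_of_le_of_ne (gauss_nonneg f) fun h =>
    h0 ((gauss_eq_zero hρ hf).1 h.symm)
  have hfin : {I | ‖MvPowerSeries.coeff I f‖ * weight ρ I = gauss ρ f}.Finite :=
    (finite_lt_coeff hf (half_pos hpos)).subset fun I hI => by
      simp only [Set.mem_ofPred_eq] at hI ⊢
      linarith
  refine ⟨hfin.toFinset, ?_, fun I => by simp⟩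
  by_contra hne
  have hne : ∀ I, ‖MvPowerSeries.coeff I f‖ * weight ρ I < gauss ρ f := fun I =>
    lt_of_le_of_ne (le_gauss hf I) fun h => hne ⟨I, by simpa using h⟩
  have hfin2 := (finite_lt_coeff hf (half_pos hpos)).image
    fun I => ‖MvPowerSeries.coeff I f‖ * weight ρ I
  obtain ⟨t, ht, hle⟩ : ∃ t < gauss ρ f, ∀ I, ‖MvPowerSeries.coeff I f‖ * weight ρ I ≤ t := by
    rcases Set.eq_empty_or_nonempty
      {I | gauss ρ f / 2 < ‖MvPowerSeries.coeff I f‖ * weight ρ I} with h | h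
    · refine ⟨gauss ρ f / 2, by linarith, fun I => ?_⟩
      by_contra hI
      exact (h ▸ (not_le.1 hI : I ∈ {I | gauss ρ f / 2 < ‖MvPowerSeries.coeff I f‖ * weight ρ I}) :
        I ∈ (∅ : Set _))
    · obtain ⟨J, hJ, hmax⟩ := Set.exists_max_image _
        (fun I => ‖MvPowerSeries.coeff I f‖ * weight ρ I) (finite_lt_coeff hf (half_pos hpos)) h
      refine ⟨_, hne J, fun I => ?_⟩
      by_cases hI : gauss ρ f / 2 < ‖MvPowerSeries.coeff I f‖ * weight ρ I
      · exact hmax I hI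
      · exact (not_lt.1 hI).trans (le_of_lt hJ)
  exact absurd (gauss_le hle) (not_le.2 ht)

theorem gauss_mul (hρ : ∀ i, 0 < ρ i) {f g : MvPowerSeries (Fin n) k}
    (hf : f ∈ tateAlgebra k ρ) (hg : g ∈ tateAlgebra k ρ) :
    gauss ρ (f * g) = gauss ρ f * gauss ρ g := by
  classical
  by_cases hf0 : f = 0
  · simp [hf0, gauss_zero]
  by_cases hg0 : g = 0
  · simp [hg0, gauss_zero]
  obtain ⟨F, hF, hFm⟩ := exists_gauss_eq hρ hf hf0
  obtain ⟨G, hG, hGm⟩ := exists_gauss_eq hρ hg hg0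
  obtain ⟨I, hI, J, hJ, hIJ⟩ := UniqueSums.uniqueAdd_of_nonempty hF hG
  have hfpos : 0 < gauss ρ f := lt_of_le_of_ne (gauss_nonneg f) fun h =>
    hf0 ((gauss_eq_zero hρ hf).1 h.symm)
  have hgpos : 0 < gauss ρ g := lt_of_le_of_ne (gauss_nonneg g) fun h =>
    hg0 ((gauss_eq_zero hρ hg).1 h.symm)
  refine MvPowerSeries.gaussNorm_mul_eq_mul _ _ _ _ (hasGaussNorm hf) (hasGaussNorm hg)
    (hasGaussNorm (mul_mem hf hg)) (fun _ => norm_nonneg _) norm_zero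
    IsUltrametricDist.norm_add_le_max (fun _ _ => norm_mul _ _) norm_neg
    (fun _ => norm_eq_zero.1) hρ ⟨I, J, (hFm I).1 hI, (hGm J).1 hJ, ?_⟩
  rintro ⟨I', J'⟩ hmem hne
  rw [Finset.HasAntidiagonal.mem_antidiagonal] at hmem
  dsimp only at hmem ⊢
  have key : ‖MvPowerSeries.coeff I' f‖ * weight ρ I' * (‖MvPowerSeries.coeff J' g‖ * weight ρ J') <
      gauss ρ f * gauss ρ g := by
    by_cases h1 : I' ∈ F
    · have h2 : J' ∉ G := fun h2 => hne (by
        obtain ⟨rfl, rfl⟩ := hIJ h1 h2 hmem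
        rfl)
      have h2' := lt_of_le_of_ne (le_gauss hg J') fun h => h2 ((hGm J').2 h)
      rw [(hFm I').1 h1]
      exact mul_lt_mul_of_pos_left h2' hfpos
    · have h1' := lt_of_le_of_ne (le_gauss hf I') fun h => h1 ((hFm I').2 h)
      exact mul_lt_mul_of_lt_of_le_of_nonneg_of_pos h1' (le_gauss hg J')
        (mul_nonneg (norm_nonneg _) (weight_pos hρ _).le) hgpos
  rw [← (hFm I).1 hI, ← (hGm J).1 hJ] at key
  have hw : weight ρ I' * weight ρ J' = weight ρ I * weight ρ J := by
    rw [← weight_add, hmem, weight_add]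
  have hwpos := mul_pos (weight_pos hρ I) (weight_pos hρ J)
  rw [norm_mul]
  refine lt_of_mul_lt_mul_right ?_ hwpos.le
  calc _ = ‖MvPowerSeries.coeff I' f‖ * ‖MvPowerSeries.coeff J' g‖ *
        (weight ρ I' * weight ρ J') := by rw [hw]
    _ = ‖MvPowerSeries.coeff I' f‖ * weight ρ I' * (‖MvPowerSeries.coeff J' g‖ * weight ρ J') := by
        ring
    _ < _ := key
    _ = _ := by ring

theorem gauss_monomial (hρ : ∀ i, 0 < ρ i) (I : Fin n →₀ ℕ) (a : k) :
    gauss ρ (MvPowerSeries.monomial I a) = ‖a‖ * weight ρ I := by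
  classical
  refine le_antisymm (gauss_le fun J => ?_) ?_
  · rw [MvPowerSeries.coeff_monomial]
    split_ifs with h
    · rw [h]
    · simpa using mul_nonneg (norm_nonneg a) (weight_pos hρ I).le
  · have := le_gauss (MvPowerSeries.isRestricted_monomial ρ I a : _ ∈ tateAlgebra k ρ) I
    rwa [MvPowerSeries.coeff_monomial_same] at this

theorem gauss_C (hρ : ∀ i, 0 < ρ i) (a : k) :
    gauss ρ (MvPowerSeries.C a : MvPowerSeries (Fin n) k) = ‖a‖ := by
  simpa using gauss_monomial (k := k) hρ 0 a

theorem gauss_one (hρ : ∀ i, 0 < ρ i) : gauss ρ (1 : MvPowerSeries (Fin n) k) = 1 := by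
  simpa using gauss_C (k := k) hρ 1

theorem gauss_X (hρ : ∀ i, 0 < ρ i) (i : Fin n) :
    gauss ρ (MvPowerSeries.X i : MvPowerSeries (Fin n) k) = ρ i := by
  simpa [MvPowerSeries.X] using gauss_monomial (k := k) hρ (Finsupp.single i 1) 1

theorem X_mem_tateAlgebra (i : Fin n) :
    (MvPowerSeries.X i : MvPowerSeries (Fin n) k) ∈ tateAlgebra k ρ :=
  MvPowerSeries.isRestricted_monomial ρ _ _

theorem C_mem_tateAlgebra (c : k) :
    (MvPowerSeries.C c : MvPowerSeries (Fin n) k) ∈ tateAlgebra k ρ :=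
  MvPowerSeries.isRestricted_C ρ c

theorem tateAlgebra_mono {ρ' : Fin n → ℝ} (hρ : ∀ i, 0 < ρ i) (h : ∀ i, ρ i ≤ ρ' i) :
    tateAlgebra k ρ' ≤ tateAlgebra k ρ := fun _ hf =>
  squeeze_zero (fun I => mul_nonneg (norm_nonneg _) (weight_pos hρ I).le)
    (fun I => mul_le_mul_of_nonneg_left (weight_mono (fun i => (hρ i).le) h I) (norm_nonneg _))
    (mem_tateAlgebra.1 hf)

theorem gauss_mono {ρ' : Fin n → ℝ} (hρ : ∀ i, 0 < ρ i) (h : ∀ i, ρ i ≤ ρ' i)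
    {f : MvPowerSeries (Fin n) k} (hf : f ∈ tateAlgebra k ρ') : gauss ρ f ≤ gauss ρ' f :=
  gauss_le fun I => (mul_le_mul_of_nonneg_left (weight_mono (fun i => (hρ i).le) h I)
    (norm_nonneg _)).trans (le_gauss hf I)

theorem coe_mem_tateAlgebra (P : MvPolynomial (Fin n) k) :
    (P : MvPowerSeries (Fin n) k) ∈ tateAlgebra k ρ := by
  refine mem_tateAlgebra.2 (tendsto_nhds_of_eventually_eq ?_)
  refine (P.support.finite_toSet).subset fun I hI => ?_
  by_contra h
  exact hI (by simp [MvPolynomial.notMem_support_iff.1 h])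

/-- The part of a power series supported on a finite set of multi-indices. -/
noncomputable def truncation (F : Finset (Fin n →₀ ℕ)) (f : MvPowerSeries (Fin n) k) :
    MvPolynomial (Fin n) k := ∑ I ∈ F, MvPolynomial.monomial I (MvPowerSeries.coeff I f)

open Classical in
theorem coeff_truncation (F : Finset (Fin n →₀ ℕ)) (f : MvPowerSeries (Fin n) k)
    (I : Fin n →₀ ℕ) : MvPowerSeries.coeff I (truncation F f : MvPowerSeries (Fin n) k) =
      if I ∈ F then MvPowerSeries.coeff I f else 0 := by
  rw [MvPolynomial.coeff_coe, truncation, MvPolynomial.coeff_sum]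
  simp [MvPolynomial.coeff_monomial]

theorem exists_truncation {f : MvPowerSeries (Fin n) k}
    (hf : f ∈ tateAlgebra k ρ) {ε : ℝ} (hε : 0 < ε) :
    ∃ F : Finset (Fin n →₀ ℕ), gauss ρ (f - (truncation F f : MvPowerSeries (Fin n) k)) ≤ ε := by
  refine ⟨(finite_lt_coeff hf hε).toFinset, gauss_le fun I => ?_⟩
  rw [map_sub, coeff_truncation]
  split_ifs with h
  · simpa using hε.le
  · simpa using h

end Gauss

/-! ### Sums of families of power series -/

section Sum

variable {k : Type*} [NormedField k] [IsUltrametricDist k] [CompleteSpace k] {n : ℕ}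
  {ρ : Fin n → ℝ} {ι : Type*}

/-- The coefficientwise sum of a family of power series. -/
noncomputable def seriesSum (u : ι → MvPowerSeries (Fin n) k) : MvPowerSeries (Fin n) k :=
  fun I => ∑' i, MvPowerSeries.coeff I (u i)

omit [IsUltrametricDist k] [CompleteSpace k] in
theorem coeff_seriesSum (u : ι → MvPowerSeries (Fin n) k) (I : Fin n →₀ ℕ) :
    MvPowerSeries.coeff I (seriesSum u) = ∑' i, MvPowerSeries.coeff I (u i) := rfl

variable {u : ι → MvPowerSeries (Fin n) k}

theorem summable_coeff (hρ : ∀ i, 0 < ρ i) (hu : ∀ i, u i ∈ tateAlgebra k ρ)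
    (hlim : Tendsto (fun i => gauss ρ (u i)) cofinite (𝓝 0)) (I : Fin n →₀ ℕ) :
    Summable fun i => MvPowerSeries.coeff I (u i) := by
  refine NonarchimedeanAddGroup.summable_of_tendsto_cofinite_zero ?_
  rw [tendsto_zero_iff_norm_tendsto_zero]
  refine squeeze_zero (fun _ => norm_nonneg _) (fun i => ?_)
    (by simpa using hlim.mul_const (weight ρ I)⁻¹)
  rw [← div_eq_mul_inv, le_div_iff₀ (weight_pos hρ I)]
  exact le_gauss (hu i) I

theorem norm_coeff_seriesSum_sub_le (hρ : ∀ i, 0 < ρ i) (hu : ∀ i, u i ∈ tateAlgebra k ρ)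
    (hlim : Tendsto (fun i => gauss ρ (u i)) cofinite (𝓝 0)) (F : Finset ι) {ε : ℝ} (hε : 0 ≤ ε)
    (hF : ∀ i, i ∉ F → gauss ρ (u i) ≤ ε) (I : Fin n →₀ ℕ) :
    ‖MvPowerSeries.coeff I (seriesSum u - ∑ i ∈ F, u i)‖ * weight ρ I ≤ ε := by
  rw [map_sub, map_sum, coeff_seriesSum, ← (summable_coeff hρ hu hlim I).sum_add_tsum_subtype_compl F,
    add_sub_cancel_left, ← le_div_iff₀ (weight_pos hρ I)]
  refine IsUltrametricDist.norm_tsum_le_of_forall_le_of_nonneg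
    (div_nonneg hε (weight_pos hρ I).le) fun i => ?_
  rw [le_div_iff₀ (weight_pos hρ I)]
  exact (le_gauss (hu i) I).trans (hF i i.2)

theorem seriesSum_mem (hρ : ∀ i, 0 < ρ i) (hu : ∀ i, u i ∈ tateAlgebra k ρ)
    (hlim : Tendsto (fun i => gauss ρ (u i)) cofinite (𝓝 0)) :
    seriesSum u ∈ tateAlgebra k ρ := by
  rw [mem_tateAlgebra, NormedAddGroup.tendsto_nhds_zero]
  intro ε hε
  have h1 := hlim.eventually (eventually_le_nhds (half_pos hε))
  rw [eventually_cofinite] at h1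
  have hF : ∀ i, i ∉ h1.toFinset → gauss ρ (u i) ≤ ε / 2 := fun i hi => by simpa using hi
  have h2 : ∑ i ∈ h1.toFinset, u i ∈ tateAlgebra k ρ := sum_mem fun i _ => hu i
  filter_upwards [(mem_tateAlgebra.1 h2).eventually (eventually_lt_nhds hε)] with I hI
  rw [Real.norm_of_nonneg (mul_nonneg (norm_nonneg _) (weight_pos hρ I).le)]
  have h3 := norm_coeff_seriesSum_sub_le hρ hu hlim _ (half_pos hε).le hF I
  have h4 : MvPowerSeries.coeff I (seriesSum u) =
      MvPowerSeries.coeff I (seriesSum u - ∑ i ∈ h1.toFinset, u i) +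
        MvPowerSeries.coeff I (∑ i ∈ h1.toFinset, u i) := by rw [← map_add, sub_add_cancel]
  rw [h4]
  refine (mul_le_mul_of_nonneg_right (IsUltrametricDist.norm_add_le_max _ _)
    (weight_pos hρ I).le).trans_lt ?_
  rw [max_mul_of_nonneg _ _ (weight_pos hρ I).le]
  exact max_lt (h3.trans_lt (by linarith)) hI

theorem gauss_seriesSum_sub_le (hρ : ∀ i, 0 < ρ i) (hu : ∀ i, u i ∈ tateAlgebra k ρ)
    (hlim : Tendsto (fun i => gauss ρ (u i)) cofinite (𝓝 0)) (F : Finset ι) {ε : ℝ} (hε : 0 ≤ ε)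
    (hF : ∀ i, i ∉ F → gauss ρ (u i) ≤ ε) : gauss ρ (seriesSum u - ∑ i ∈ F, u i) ≤ ε :=
  gauss_le (norm_coeff_seriesSum_sub_le hρ hu hlim F hε hF)

theorem gauss_seriesSum_le (hρ : ∀ i, 0 < ρ i) (hu : ∀ i, u i ∈ tateAlgebra k ρ)
    (hlim : Tendsto (fun i => gauss ρ (u i)) cofinite (𝓝 0)) {ε : ℝ} (hε : 0 ≤ ε)
    (H : ∀ i, gauss ρ (u i) ≤ ε) : gauss ρ (seriesSum u) ≤ ε := by
  simpa using gauss_seriesSum_sub_le hρ hu hlim ∅ hε fun i _ => H i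

end Sum

section Radii

variable {n : ℕ} {ρ r : Fin n → ℝ}

theorem isInnerRadius_smul (hr : ∀ i, 0 < r i) {c : ℝ} (h0 : 0 < c) (h1 : c < 1) :
    IsInnerRadius (fun i => c * r i) r := fun i =>
  ⟨mul_pos h0 (hr i), by simpa using mul_lt_mul_of_pos_right h1 (hr i)⟩

theorem IsInnerRadius.pos (h : IsInnerRadius ρ r) (i : Fin n) : 0 < ρ i := (h i).1

theorem IsInnerRadius.max {ρ' : Fin n → ℝ} (h : IsInnerRadius ρ r) (h' : IsInnerRadius ρ' r) :
    IsInnerRadius (fun i => max (ρ i) (ρ' i)) r := fun i =>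
  ⟨lt_max_of_lt_left (h i).1, max_lt (h i).2 (h' i).2⟩

theorem eventually_lt_mul {a b : ℝ} (h : a < b) : ∀ᶠ c in 𝓝[<] (1 : ℝ), a < c * b := by
  have : Tendsto (fun c : ℝ => c * b) (𝓝 1) (𝓝 b) := by
    simpa using (by fun_prop : Continuous fun c : ℝ => c * b).tendsto 1
  exact (this.eventually (eventually_gt_nhds h)).filter_mono nhdsWithin_le_nhds

theorem eventually_pos_lt_one : ∀ᶠ c in 𝓝[<] (1 : ℝ), 0 < c ∧ c < 1 := by
  filter_upwards [Ioo_mem_nhdsLT (zero_lt_one (α := ℝ))] with c hc using hc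

theorem IsInnerRadius.eventually_le (h : IsInnerRadius ρ r) :
    ∀ᶠ c in 𝓝[<] (1 : ℝ), (0 < c ∧ c < 1) ∧ ∀ i, ρ i ≤ c * r i :=
  eventually_pos_lt_one.and <| eventually_all.2 fun i =>
    (eventually_lt_mul (h i).2).mono fun _ hc => hc.le

end Radii

section Points

variable {k : Type*} [NormedField k] [IsUltrametricDist k] {n : ℕ} {ρ r : Fin n → ℝ}

/-- The point of the open polydisc given by the Gauss norm of an inner polyradius. -/
noncomputable def gaussPoint (hρ : IsInnerRadius ρ r) : OpenPolydisc k r where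
  seminorm :=
    { toFun := fun h => gauss ρ (h : MvPowerSeries (Fin n) k)
      map_zero' := gauss_zero
      add_le' := fun f g => (gauss_add_le hρ.pos (f.2 ρ hρ) (g.2 ρ hρ)).trans
        (max_le_add_of_nonneg (gauss_nonneg _) (gauss_nonneg _))
      neg' := fun _ => gauss_neg _
      map_one' := gauss_one hρ.pos
      map_mul' := fun f g => gauss_mul hρ.pos (f.2 ρ hρ) (g.2 ρ hρ) }
  nonarchimedean f g := gauss_add_le hρ.pos (f.2 ρ hρ) (g.2 ρ hρ)
  bounded := ⟨ρ, hρ, fun _ => le_rfl⟩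

theorem continuous_eval (h : functions k r) : Continuous fun x : OpenPolydisc k r => x h :=
  (continuous_apply h).comp continuous_induced_dom

theorem le_of_forall_pow_mul_le {A t : ℝ} (d : ℕ)
    (h : ∀ c : ℝ, 0 < c → c < 1 → c ^ d * A ≤ t) : A ≤ t := by
  have : Tendsto (fun c : ℝ => c ^ d * A) (𝓝[<] 1) (𝓝 A) := by
    refine Tendsto.mono_left ?_ nhdsWithin_le_nhds
    simpa using (by fun_prop : Continuous fun c : ℝ => c ^ d * A).tendsto 1
  exact le_of_tendsto this (eventually_pos_lt_one.mono fun c hc => h c hc.1 hc.2)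

theorem supNorm_le_iff (hr : ∀ i, 0 < r i) {h : functions k r} {t : ℝ} (ht : 0 ≤ t) :
    supNorm h ≤ ENNReal.ofReal t ↔
      ∀ I, ‖MvPowerSeries.coeff I (h : MvPowerSeries (Fin n) k)‖ * weight r I ≤ t := by
  constructor
  · intro H I
    refine le_of_forall_pow_mul_le I.degree fun c h0 h1 => ?_
    have hc := isInnerRadius_smul hr h0 h1
    have h2 := (le_gauss (h.2 _ hc) I).trans (le_of_supNorm_le ht H (gaussPoint hc))
    rw [weight_smul] at h2
    linarith
  · intro H
    refine iSup_le fun x => ENNReal.ofReal_le_ofReal ?_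
    obtain ⟨ρ, hρ, hx⟩ := x.bounded
    refine (hx h).trans (gauss_le fun I => le_trans ?_ (H I))
    exact mul_le_mul_of_nonneg_left (weight_mono (fun i => (hρ i).1.le) (fun i => (hρ i).2.le) I)
      (norm_nonneg _)

theorem mem_le_iff (hr : ∀ i, 0 < r i) {h : functions k r} {t : Degree} :
    h ∈ (functionFiltration k r).le t ↔
      ∀ I, ‖MvPowerSeries.coeff I (h : MvPowerSeries (Fin n) k)‖ * weight r I ≤ t.val :=
  supNorm_le_iff hr t.val_pos.le

theorem coeff_lt_of_supNorm_lt (hr : ∀ i, 0 < r i) {h : functions k r} {t : ℝ}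
    (H : supNorm h < ENNReal.ofReal t) (I : Fin n →₀ ℕ) :
    ‖MvPowerSeries.coeff I (h : MvPowerSeries (Fin n) k)‖ * weight r I < t := by
  have hfin : supNorm h ≠ ⊤ := (H.trans_le le_top).ne
  have h1 : (supNorm h).toReal < t := (ENNReal.lt_ofReal_iff_toReal_lt hfin).1 H
  exact ((supNorm_le_iff hr ENNReal.toReal_nonneg).1 (ENNReal.ofReal_toReal hfin).ge I).trans_lt h1

/-- A power series with bounded weighted coefficients converges on the open polydisc. -/
theorem mem_functions_of_bounded (hr : ∀ i, 0 < r i) {h : MvPowerSeries (Fin n) k} {t : ℝ}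
    (H : ∀ I, ‖MvPowerSeries.coeff I h‖ * weight r I ≤ t) : h ∈ functions k r := by
  intro ρ hρ
  obtain ⟨c, ⟨h0, h1⟩, hc⟩ := hρ.eventually_le.exists
  refine tateAlgebra_mono hρ.pos hc (mem_tateAlgebra.2 ?_)
  refine squeeze_zero (fun I => mul_nonneg (norm_nonneg _)
    (weight_pos (fun i => mul_pos h0 (hr i)) I).le) (fun I => ?_)
    (by simpa using (tendsto_pow_degree h0.le h1).mul_const t)
  rw [weight_smul, mul_left_comm]
  exact mul_le_mul_of_nonneg_left (H I) (pow_nonneg h0.le _)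

theorem coe_aeval_coordinate (P : MvPolynomial (Fin n) k) :
    ((MvPolynomial.aeval (coordinate r) P : functions k r) : MvPowerSeries (Fin n) k) = P := by
  have : (functions k r).val.comp (MvPolynomial.aeval (coordinate r)) =
      MvPolynomial.coeToMvPowerSeries.algHom k := by
    refine MvPolynomial.algHom_ext fun i => ?_
    simp [coordinate]
  simpa using DFunLike.congr_fun this P

theorem OpenPolydisc.sum_le (x : OpenPolydisc k r) {ι : Type*} (F : Finset ι)
    (u : ι → functions k r) {t : ℝ} (ht : 0 ≤ t) (H : ∀ i ∈ F, x (u i) ≤ t) :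
    x (∑ i ∈ F, u i) ≤ t := by
  classical
  induction F using Finset.induction_on with
  | empty => simpa using ht
  | insert a F ha ih =>
    rw [Finset.sum_insert ha]
    exact (x.nonarchimedean _ _).trans (max_le (H a (by simp)) (ih fun i hi => H i (by simp [hi])))

theorem OpenPolydisc.algebraMap_le (x : OpenPolydisc k r) (c : k) :
    x (algebraMap k (functions k r) c) ≤ ‖c‖ := by
  obtain ⟨ρ, -, hx⟩ := x.bounded
  exact (hx _).trans (gauss_C_le ρ c)

theorem OpenPolydisc.coordinate_lt (x : OpenPolydisc k r) (i : Fin n) :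
    x (coordinate r i) < r i := by
  obtain ⟨ρ, hρ, hx⟩ := x.bounded
  exact ((hx _).trans (gauss_X hρ.pos i).le).trans_lt (hρ i).2

/-- A point lies in a closed polydisc as soon as the coordinate functions are bounded by the
polyradius there. -/
theorem OpenPolydisc.mem_closedPolydisc (x : OpenPolydisc k r) {σ : Fin n → ℝ}
    (hσ : IsInnerRadius σ r) (H : ∀ i, x (coordinate r i) ≤ σ i) : x ∈ closedPolydisc k r σ := by
  intro h
  refine le_of_forall_pos_le_add fun ε hε => ?_
  obtain ⟨ρ, hρ, hx⟩ := x.bounded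
  have hτ := hρ.max hσ
  obtain ⟨F, hF⟩ := exists_truncation (h.2 _ hτ) hε
  set P := truncation F (h : MvPowerSeries (Fin n) k) with hP
  set p : functions k r := MvPolynomial.aeval (coordinate r) P with hp
  have h1 : x (h - p) ≤ ε := by
    refine (hx _).trans (le_trans ?_ hF)
    rw [← coe_aeval_coordinate (r := r)]
    exact gauss_mono hρ.pos (fun i => le_max_left _ _) ((h - p).2 _ hτ)
  have h2 : x p ≤ gauss σ (h : MvPowerSeries (Fin n) k) := by
    rw [hp, hP, truncation, map_sum]
    refine x.sum_le _ _ (gauss_nonneg _) fun I _ => ?_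
    rw [MvPolynomial.aeval_monomial, map_mul]
    refine (mul_le_mul (x.algebraMap_le _) ?_ (apply_nonneg _ _) (norm_nonneg _)).trans
      (le_gauss (h.2 _ hσ) I)
    rw [Finsupp.prod_fintype _ _ fun _ => pow_zero _, map_prod, weight_eq_prod]
    refine Finset.prod_le_prod (fun i _ => apply_nonneg _ _) fun i _ => ?_
    rw [map_pow]
    exact pow_le_pow_left₀ (apply_nonneg _ _) (H i) _
  have h3 := x.nonarchimedean (h - p) p
  rw [sub_add_cancel] at h3
  refine h3.trans (max_le (h1.trans ?_) (h2.trans ?_))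
  · linarith [gauss_nonneg (ρ := σ) (h : MvPowerSeries (Fin n) k)]
  · linarith

/-- A compact subset of the open polydisc is contained in a closed polydisc. -/
theorem exists_subset_closedPolydisc (hr : ∀ i, 0 < r i) {K : Set (OpenPolydisc k r)}
    (hK : IsCompact K) : ∃ σ, IsInnerRadius σ r ∧ K ⊆ closedPolydisc k r σ := by
  have : ∀ i, ∃ M, M < r i ∧ ∀ x ∈ K, x (coordinate r i) ≤ M := by
    intro i
    rcases K.eq_empty_or_nonempty with rfl | hne
    · exact ⟨0, hr i, by simp⟩
    · obtain ⟨x, hx, hmax⟩ := hK.exists_isMaxOn hne (continuous_eval (coordinate r i)).continuousOn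
      exact ⟨_, x.coordinate_lt i, fun y hy => hmax hy⟩
  choose M hM hKM using this
  have hσ : IsInnerRadius (fun i => max (M i) (r i / 2)) r := fun i =>
    ⟨lt_max_of_lt_right (half_pos (hr i)), max_lt (hM i) (half_lt_self (hr i))⟩
  exact ⟨_, hσ, fun x hx => x.mem_closedPolydisc hσ fun i =>
    (hKM i x hx).trans (le_max_left _ _)⟩

theorem mem_lt_iff (hr : ∀ i, 0 < r i) {h : functions k r} {t : Degree} :
    h ∈ (functionFiltration k r).lt t ↔
      ∀ I, ‖MvPowerSeries.coeff I (h : MvPowerSeries (Fin n) k)‖ * weight r I < t.val := by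
  constructor
  · intro H I
    have hc := isInnerRadius_smul hr (c := 1 / 2) (by norm_num) (by norm_num)
    have hpos : 0 < t.val * (1 / 2) ^ I.degree / 2 := by
      have := t.val_pos
      positivity
    obtain ⟨g, hg, hgK⟩ := H {gaussPoint hc} isCompact_singleton _ hpos
    have h1 := (le_gauss ((h - g).2 _ hc) I).trans (hgK _ rfl)
    have h2 := coeff_lt_of_supNorm_lt hr hg I
    rw [weight_smul] at h1
    have h3 : ‖MvPowerSeries.coeff I ((h - g : functions k r) : MvPowerSeries (Fin n) k)‖ *
        weight r I ≤ t.val / 2 := by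
      have h4 : (0 : ℝ) < (1 / 2) ^ I.degree := by positivity
      refine le_of_mul_le_mul_left ?_ h4
      linarith
    have h5 : MvPowerSeries.coeff I (h : MvPowerSeries (Fin n) k) =
        MvPowerSeries.coeff I ((h - g : functions k r) : MvPowerSeries (Fin n) k) +
        MvPowerSeries.coeff I (g : MvPowerSeries (Fin n) k) := by
      rw [← map_add, ← AddMemClass.coe_add, sub_add_cancel]
    rw [h5]
    refine (mul_le_mul_of_nonneg_right (IsUltrametricDist.norm_add_le_max _ _)
      (weight_pos hr I).le).trans_lt ?_
    rw [max_mul_of_nonneg _ _ (weight_pos hr I).le]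
    exact max_lt (h3.trans_lt (half_lt_self t.val_pos)) h2
  · intro H K hK ε hε
    obtain ⟨σ, hσ, hKσ⟩ := exists_subset_closedPolydisc hr hK
    obtain ⟨F, hF⟩ := exists_truncation (h.2 _ hσ) hε
    set P := truncation F (h : MvPowerSeries (Fin n) k) with hP
    refine ⟨MvPolynomial.aeval (coordinate r) P, ?_, fun x hx => ?_⟩
    · have h1 : ∀ᶠ t' in 𝓝[<] t.val, 0 < t' ∧ t' < t.val := by
        filter_upwards [Ioo_mem_nhdsLT t.val_pos] with c hc using hc
      have h2 : ∀ᶠ t' in 𝓝[<] t.val, ∀ I ∈ F,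
          ‖MvPowerSeries.coeff I (h : MvPowerSeries (Fin n) k)‖ * weight r I < t' :=
        (eventually_all_finset F).2 fun I _ =>
          (eventually_gt_nhds (H I)).filter_mono nhdsWithin_le_nhds
      obtain ⟨t', ⟨h0, hlt⟩, h3⟩ := (h1.and h2).exists
      refine lt_of_le_of_lt ((supNorm_le_iff hr h0.le).2 fun I => ?_)
        ((ENNReal.ofReal_lt_ofReal_iff t.val_pos).2 hlt)
      rw [coe_aeval_coordinate, coeff_truncation]
      split_ifs with hI
      · exact (h3 I hI).le
      · simpa using h0.le
    · refine (hKσ hx _).trans ?_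
      rw [AddSubgroupClass.coe_sub, coe_aeval_coordinate]
      exact hF

end Points

section Homogeneous

variable {A : Type*} [CommRing A] {F : Filtration A}

open Classical in
/-- The homogeneous element of degree `t` defined by `a`, or `0` if `a` is not of size at
most `t`. -/
noncomputable def hom (F : Filtration A) (t : Degree) (a : A) : GradedReduction F :=
  if h : a ∈ F.le t then DirectSum.of (Piece F) t (Piece.mk F t a h) else 0

theorem hom_of_mem {t : Degree} {a : A} (h : a ∈ F.le t) :
    hom F t a = DirectSum.of (Piece F) t (Piece.mk F t a h) := dif_pos h

theorem exists_of_eq_hom {t : Degree} (p : Piece F t) :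
    ∃ (a : A) (ha : a ∈ F.le t), Piece.mk F t a ha = p ∧ DirectSum.of (Piece F) t p = hom F t a := by
  induction p using Piece.ind with
  | h a ha => exact ⟨a, ha, rfl, (hom_of_mem ha).symm⟩

theorem mk_eq_zero {t : Degree} {a : A} (ha : a ∈ F.le t) :
    Piece.mk F t a ha = 0 ↔ a ∈ F.lt t := by
  rw [← Piece.mk_zero, eq_comm, Piece.mk_eq_mk]
  simp

theorem hom_eq_zero {t : Degree} {a : A} (ha : a ∈ F.le t) : hom F t a = 0 ↔ a ∈ F.lt t := by
  rw [hom_of_mem ha, ← mk_eq_zero ha]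
  exact ⟨fun h => DirectSum.of_injective t (by rw [h, map_zero]), fun h => by rw [h, map_zero]⟩

theorem hom_add {t : Degree} {a b : A} (ha : a ∈ F.le t) (hb : b ∈ F.le t) :
    hom F t (a + b) = hom F t a + hom F t b := by
  rw [hom_of_mem ha, hom_of_mem hb, hom_of_mem ((F.le t).add_mem ha hb), Piece.mk_add, map_add]

theorem hom_zero (t : Degree) : hom F t 0 = 0 := by
  rw [hom_of_mem (F.le t).zero_mem, Piece.mk_zero, map_zero]

theorem hom_sum {t : Degree} {ι : Type*} (S : Finset ι) {a : ι → A} (ha : ∀ i ∈ S, a i ∈ F.le t) :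
    hom F t (∑ i ∈ S, a i) = ∑ i ∈ S, hom F t (a i) := by
  classical
  induction S using Finset.induction_on with
  | empty => simp [hom_zero]
  | insert i S hi ih =>
    rw [Finset.sum_insert hi, Finset.sum_insert hi, hom_add (ha i (by simp))
      (sum_mem fun j hj => ha j (by simp [hj])), ih fun j hj => ha j (by simp [hj])]

theorem hom_mul {s t : Degree} {a b : A} (ha : a ∈ F.le s) (hb : b ∈ F.le t) :
    hom F s a * hom F t b = hom F (s + t) (a * b) := by
  rw [hom_of_mem ha, hom_of_mem hb, hom_of_mem (F.mul_mem ha hb), DirectSum.of_mul_of,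
    Piece.gmul_mk]

theorem hom_one : hom F 0 1 = 1 := hom_of_mem F.one_mem

theorem hom_apply_self {t : Degree} {a : A} (ha : a ∈ F.le t) :
    hom F t a t = Piece.mk F t a ha := by
  rw [hom_of_mem ha, DirectSum.of_eq_same]

theorem hom_apply_of_ne {s t : Degree} (a : A) (h : s ≠ t) : hom F s a t = 0 := by
  unfold hom
  split_ifs
  · exact DirectSum.of_eq_of_ne _ _ _ h.symm
  · rfl

theorem reduction_induction {P : GradedReduction F → Prop} (x : GradedReduction F) (h0 : P 0)
    (hadd : ∀ x y, P x → P y → P (x + y)) (h : ∀ t, ∀ a ∈ F.le t, P (hom F t a)) : P x := by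
  induction x using DirectSum.induction_on with
  | zero => exact h0
  | of t p =>
    obtain ⟨a, ha, -, e⟩ := exists_of_eq_hom p
    rw [e]
    exact h t a ha
  | add x y hx hy => exact hadd x y hx hy

/-- The product of a homogeneous element with an arbitrary one, in a given degree. -/
theorem hom_mul_apply {s t : Degree} {a b : A} (ha : a ∈ F.le s) (hb : b ∈ F.le t)
    (x : GradedReduction F) (hx : x t = Piece.mk F t b hb) :
    (hom F s a * x) (s + t) = Piece.mk F (s + t) (a * b) (F.mul_mem ha hb) := by
  classical
  have key : (hom F s a * (x - hom F t b)) (s + t) = 0 := by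
    have hx' : (x - hom F t b) t = 0 := by
      rw [DirectSum.sub_apply, hx, hom_apply_self hb, sub_self]
    generalize x - hom F t b = y at hx' ⊢
    rw [← DirectSum.sum_support_of y, Finset.mul_sum, DFinsupp.finsetSum_apply]
    refine Finset.sum_eq_zero fun u hu => ?_
    have hut : u ≠ t := fun h => DFinsupp.mem_support_iff.1 hu (h ▸ hx')
    obtain ⟨c, hc, -, e⟩ := exists_of_eq_hom (y u)
    rw [e, hom_mul ha hc]
    exact hom_apply_of_ne _ fun h => hut (add_left_cancel h)
  rw [mul_sub, hom_mul ha hb, DirectSum.sub_apply, hom_apply_self (F.mul_mem ha hb),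
    sub_eq_zero] at key
  exact key

variable {B : Type*} [CommRing B] {G : Filtration B}

theorem map_hom (u : A →+* B) (hle : ∀ t, ∀ a ∈ F.le t, u a ∈ G.le t)
    (hlt : ∀ t, ∀ a ∈ F.lt t, u a ∈ G.lt t) {t : Degree} {a : A} (ha : a ∈ F.le t) :
    GradedReduction.map u hle hlt (hom F t a) = hom G t (u a) := by
  rw [hom_of_mem ha, hom_of_mem (hle t a ha)]
  exact DirectSum.toAddMonoid_of _ _ _

theorem map_of (u : A →+* B) (hle : ∀ t, ∀ a ∈ F.le t, u a ∈ G.le t)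
    (hlt : ∀ t, ∀ a ∈ F.lt t, u a ∈ G.lt t) (t : Degree) (p : Piece F t) :
    GradedReduction.map u hle hlt (DirectSum.of (Piece F) t p) =
      DirectSum.of (Piece G) t (Piece.map u hle hlt t p) :=
  DirectSum.toAddMonoid_of _ _ _

theorem map_apply (u : A →+* B) (hle : ∀ t, ∀ a ∈ F.le t, u a ∈ G.le t)
    (hlt : ∀ t, ∀ a ∈ F.lt t, u a ∈ G.lt t) (x : GradedReduction F) (t : Degree) :
    GradedReduction.map u hle hlt x t = Piece.map u hle hlt t (x t) := by
  induction x using DirectSum.induction_on with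
  | zero => simp
  | of s p =>
    rw [map_of]
    by_cases h : s = t
    · subst h
      rw [DirectSum.of_eq_same, DirectSum.of_eq_same]
    · rw [DirectSum.of_eq_of_ne _ _ _ (Ne.symm h), DirectSum.of_eq_of_ne _ _ _ (Ne.symm h),
        map_zero]
  | add x y hx hy => rw [map_add, DirectSum.add_apply, hx, hy, DirectSum.add_apply, map_add]

theorem isHomogeneousIdeal_comap {u : A →+* B} (hle : ∀ t, ∀ a ∈ F.le t, u a ∈ G.le t)
    (hlt : ∀ t, ∀ a ∈ F.lt t, u a ∈ G.lt t) {I : Ideal (GradedReduction G)}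
    (hI : IsHomogeneousIdeal I) :
    IsHomogeneousIdeal (I.comap (GradedReduction.map u hle hlt)) := fun x hx t => by
  rw [Ideal.mem_comap, map_of, ← map_apply]
  exact hI _ hx t

/-- The additive map of graded reductions induced by an additive map which shifts the
filtrations. -/
noncomputable def mapAdd (u : A →+ B) (d : Degree → Degree)
    (hle : ∀ t, ∀ a ∈ F.le t, u a ∈ G.le (d t)) (hlt : ∀ t, ∀ a ∈ F.lt t, u a ∈ G.lt (d t)) :
    GradedReduction F →+ GradedReduction G :=
  DirectSum.toAddMonoid fun t => (DirectSum.of (Piece G) (d t)).comp <|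
    QuotientAddGroup.map _ _
      ((u.comp (F.le t).subtype).codRestrict (G.le (d t)) fun a => hle t a.1 a.2)
      (fun a ha => hlt t a.1 ha)

theorem mapAdd_hom (u : A →+ B) (d : Degree → Degree)
    (hle : ∀ t, ∀ a ∈ F.le t, u a ∈ G.le (d t)) (hlt : ∀ t, ∀ a ∈ F.lt t, u a ∈ G.lt (d t))
    {t : Degree} {a : A} (ha : a ∈ F.le t) :
    mapAdd u d hle hlt (hom F t a) = hom G (d t) (u a) := by
  rw [hom_of_mem ha, hom_of_mem (hle t a ha)]
  exact DirectSum.toAddMonoid_of _ _ _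

end Homogeneous

section Cotangent

variable {K R : Type*} [CommRing K] [CommRing R] [Algebra K R] {n : ℕ} {I : Ideal R}

/-- Generators of the kernel of a retraction of an algebra onto its base ring span its cotangent
space over the base ring. -/
theorem span_toCotangent {ε : R →+* K} (hI : ∀ x, x ∈ I ↔ ε x = 0)
    (hε : ∀ c, ε (algebraMap K R c) = c) {ι : Type*} (g : ι → R) (hg : ∀ i, g i ∈ I)
    (hspan : Ideal.span (Set.range g) = I) :
    Submodule.span K (Set.range fun i => I.toCotangent ⟨g i, hg i⟩) = ⊤ := by
  rw [eq_top_iff]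
  rintro x -
  obtain ⟨⟨x, hx⟩, rfl⟩ := Ideal.toCotangent_surjective _ x
  have hx' : x ∈ Ideal.span (Set.range g) := hspan ▸ hx
  have hle : ∀ y, y ∈ Ideal.span (Set.range g) → y ∈ I := fun y hy => hspan ▸ hy
  clear hspan
  induction hx' using Submodule.span_induction with
  | mem y hy =>
    obtain ⟨i, rfl⟩ := hy
    exact Submodule.subset_span ⟨i, rfl⟩
  | zero =>
    have : (⟨0, hx⟩ : I) = 0 := rfl
    rw [this, map_zero]
    exact zero_mem _
  | add y z hy hz hy' hz' =>
    have : (⟨y + z, hx⟩ : I) = ⟨y, hle y hy⟩ + ⟨z, hle z hz⟩ := rfl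
    rw [this, map_add]
    exact add_mem (hy' _) (hz' _)
  | smul c y hy hy' =>
    have : I.toCotangent ⟨c • y, hx⟩ = ε c • I.toCotangent ⟨y, hle y hy⟩ := by
      rw [← algebraMap_smul R (ε c), ← map_smul, Ideal.toCotangent_eq]
      change c * y - algebraMap _ _ (ε c) * y ∈ _
      rw [← sub_mul, pow_two]
      refine Ideal.mul_mem_mul ((hI _).2 ?_) (hle y hy)
      rw [map_sub, hε, sub_self]
    rw [this]
    exact Submodule.smul_mem _ _ (hy' _)

/-- A family of derivations at the augmentation induces a linear map on the cotangent space. -/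
theorem exists_cotangentCoeff {ε : R →+* K} (hI : ∀ x, x ∈ I ↔ ε x = 0)
    (hε : ∀ c, ε (algebraMap K R c) = c) {δ : Fin n → R →+ K}
    (hδ : ∀ l x y, δ l (x * y) = ε x * δ l y + ε y * δ l x)
    (hδ0 : ∀ l c, δ l (algebraMap K R c) = 0) :
    ∃ Δ : I.Cotangent →ₗ[K] (Fin n → K), ∀ (x : I) l, Δ (I.toCotangent x) l = δ l x :=
  ⟨Ideal.Cotangent.lift
    { toFun := fun x l => δ l x
      map_add' := fun x y => funext fun l => map_add (δ l) _ _
      map_smul' := fun c x => funext fun l => by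
        change δ l (c • (x : R)) = c * δ l x
        rw [Algebra.smul_def, hδ, hε, hδ0, mul_zero, add_zero] }
    (fun x y => funext fun l => by
      change δ l ((x : R) * (y : R)) = 0
      rw [hδ, (hI _).1 x.2, (hI _).1 y.2, zero_mul, zero_mul, add_zero]), fun _ _ => rfl⟩

/-- If the augmentation ideal has `n` generators which are dual to `n` derivations, then any `n`
of its generators are linearly independent in the cotangent space. -/
theorem linearIndependent_toCotangent {ε : R →+* K} (hI : ∀ x, x ∈ I ↔ ε x = 0)
    (hε : ∀ c, ε (algebraMap K R c) = c) {δ : Fin n → R →+ K}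
    (hδ : ∀ l x y, δ l (x * y) = ε x * δ l y + ε y * δ l x)
    (hδ0 : ∀ l c, δ l (algebraMap K R c) = 0) {τ : Fin n → R} (hτ : ∀ j, τ j ∈ I)
    (hδτ : ∀ l j, δ l (τ j) = if l = j then 1 else 0) (g : Fin n → R) (hg : ∀ i, g i ∈ I)
    (hspan : Ideal.span (Set.range g) = I) :
    LinearIndependent K fun i => I.toCotangent ⟨g i, hg i⟩ := by
  obtain ⟨Δ, hΔ⟩ := exists_cotangentCoeff hI hε hδ hδ0
  set v := fun i => I.toCotangent ⟨g i, hg i⟩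
  have hv : Function.Surjective (Fintype.linearCombination K v) := by
    rw [← LinearMap.range_eq_top, Fintype.range_linearCombination]
    exact span_toCotangent hI hε g hg hspan
  have hΔs : Function.Surjective Δ := fun y =>
    ⟨∑ j, y j • I.toCotangent ⟨τ j, hτ j⟩, by
      rw [map_sum]
      funext l
      rw [Finset.sum_apply]
      simp [hΔ, hδτ]⟩
  have := OrzechProperty.injective_of_surjective_endomorphism
    (Δ.comp (Fintype.linearCombination K v)) (hΔs.comp hv)
  exact linearIndependent_iff_injective_fintypeLinearCombination.2 (Function.Injective.of_comp (f := Δ) this)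

/-- Elements spanning the cotangent space have an invertible matrix of derivatives. -/
theorem exists_inverse_matrix {ε : R →+* K} (hI : ∀ x, x ∈ I ↔ ε x = 0)
    (hε : ∀ c, ε (algebraMap K R c) = c) {δ : Fin n → R →+ K}
    (hδ : ∀ l x y, δ l (x * y) = ε x * δ l y + ε y * δ l x)
    (hδ0 : ∀ l c, δ l (algebraMap K R c) = 0) {τ : Fin n → R} (hτ : ∀ j, τ j ∈ I)
    (hδτ : ∀ l j, δ l (τ j) = if l = j then 1 else 0) (g : Fin n → R) (hg : ∀ i, g i ∈ I)
    (hspan : Submodule.span K (Set.range fun i => I.toCotangent ⟨g i, hg i⟩) = ⊤) :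
    ∃ c : Matrix (Fin n) (Fin n) K, c * Matrix.of (fun i l => δ l (g i)) = 1 ∧
      Matrix.of (fun i l => δ l (g i)) * c = 1 := by
  obtain ⟨Δ, hΔ⟩ := exists_cotangentCoeff hI hε hδ hδ0
  have : ∀ j, ∃ c : Fin n → K, ∑ i, c i • I.toCotangent ⟨g i, hg i⟩ = I.toCotangent ⟨τ j, hτ j⟩ :=
    fun j => (Submodule.mem_span_range_iff_exists_fun K).1 (hspan ▸ Submodule.mem_top)
  choose c hc using this
  have key : Matrix.of c * Matrix.of (fun i l => δ l (g i)) = 1 := by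
    ext j l
    have h1 := congrFun (congrArg Δ (hc j)) l
    rw [map_sum, Finset.sum_apply] at h1
    simp only [map_smul, Pi.smul_apply, hΔ, hδτ, smul_eq_mul] at h1
    rw [Matrix.mul_apply, Matrix.one_apply]
    simpa [eq_comm] using h1
  exact ⟨_, key, mul_eq_one_comm.1 key⟩

end Cotangent

section Reduction

variable {k : Type*} [NormedField k] [IsUltrametricDist k] {n : ℕ} {r : Fin n → ℝ}

theorem mem_field_le {c : k} {t : Degree} : c ∈ (fieldFiltration k).le t ↔ ‖c‖ ≤ t.val := Iff.rfl

theorem mem_field_lt {c : k} {t : Degree} : c ∈ (fieldFiltration k).lt t ↔ ‖c‖ < t.val := Iff.rfl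

theorem Degree.val_mk (t : ℝ) (ht : 0 < t) : (Degree.mk t ht).val = t := rfl

theorem Degree.val_neg (t : Degree) : (-t).val = t.val⁻¹ := rfl

theorem Degree.val_sub (s t : Degree) : (s - t).val = s.val / t.val := by
  rw [sub_eq_add_neg, Degree.val_add, Degree.val_neg, div_eq_mul_inv]

instance : Nontrivial (GradedResidueField k) := ⟨1, 0, by
  rw [← hom_one, Ne, hom_eq_zero (Filtration.one_mem _), mem_field_lt, Degree.val_zero, norm_one]
  exact lt_irrefl _⟩

theorem reduction_eq_hom {h : functions k r} {t : Degree} (ht : supNorm h = ENNReal.ofReal t.val) :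
    reduction h = hom (functionFiltration k r) t h := by
  have h1 : (supNorm h).toReal = t.val := by rw [ht, ENNReal.toReal_ofReal t.val_pos.le]
  have h2 : 0 < (supNorm h).toReal := h1 ▸ t.val_pos
  have h3 : Degree.mk _ h2 = t := congrArg Additive.ofMul (Subtype.ext h1)
  rw [reduction, dif_pos h2, ← hom_of_mem, h3]

theorem supNorm_coordinate (hr : ∀ i, 0 < r i) (i : Fin n) :
    supNorm (coordinate (k := k) r i) = ENNReal.ofReal (r i) := by
  classical
  have hX : ∀ I, MvPowerSeries.coeff I (coordinate (k := k) r i : MvPowerSeries (Fin n) k) =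
      if I = Finsupp.single i 1 then 1 else 0 := fun I => MvPowerSeries.coeff_X I i
  refine le_antisymm ((supNorm_le_iff hr (hr i).le).2 fun I => ?_) ?_
  · rw [hX]
    split_ifs with h
    · simp [h]
    · simpa using (hr i).le
  · by_contra hlt
    have := coeff_lt_of_supNorm_lt hr (not_le.1 hlt) (Finsupp.single i 1)
    rw [hX, if_pos rfl, weight_single] at this
    simp at this

theorem coordinate_mem_le (hr : ∀ i, 0 < r i) (i : Fin n) :
    coordinate r i ∈ (functionFiltration k r).le (Degree.mk (r i) (hr i)) :=
  (supNorm_coordinate hr i).le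

/-! ### The augmentation -/

/-- The value at the origin. -/
noncomputable def evalZero (r : Fin n → ℝ) : functions k r →+* k :=
  MvPowerSeries.constantCoeff.comp (functions k r).subtype

theorem evalZero_apply (a : functions k r) :
    evalZero r a = MvPowerSeries.coeff 0 (a : MvPowerSeries (Fin n) k) := rfl

theorem evalZero_mem_le (hr : ∀ i, 0 < r i) (t : Degree) (a : functions k r)
    (ha : a ∈ (functionFiltration k r).le t) : evalZero r a ∈ (fieldFiltration k).le t := by
  have := (mem_le_iff hr).1 ha 0
  rwa [weight_zero, mul_one] at this

theorem evalZero_mem_lt (hr : ∀ i, 0 < r i) (t : Degree) (a : functions k r)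
    (ha : a ∈ (functionFiltration k r).lt t) : evalZero r a ∈ (fieldFiltration k).lt t := by
  have := (mem_lt_iff hr).1 ha 0
  rwa [weight_zero, mul_one] at this

/-- The graded reduction of the evaluation at the origin. -/
noncomputable def augmentation (hr : ∀ i, 0 < r i) :
    FunctionReduction k r →+* GradedResidueField k :=
  GradedReduction.map (evalZero r) (evalZero_mem_le hr) (evalZero_mem_lt hr)

theorem augmentation_hom (hr : ∀ i, 0 < r i) {t : Degree} {a : functions k r}
    (ha : a ∈ (functionFiltration k r).le t) :
    augmentation hr (hom _ t a) = hom (fieldFiltration k) t (evalZero r a) := map_hom _ _ _ ha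

theorem algebraMap_hom {t : Degree} {c : k} (hc : c ∈ (fieldFiltration k).le t) :
    algebraMap (GradedResidueField k) (FunctionReduction k r) (hom _ t c) =
      hom (functionFiltration k r) t (algebraMap k _ c) := map_hom _ _ _ hc

theorem evalZero_algebraMap (c : k) : evalZero r (algebraMap k (functions k r) c) = c :=
  MvPowerSeries.constantCoeff_C (σ := Fin n) c

theorem augmentation_algebraMap (hr : ∀ i, 0 < r i) (c : GradedResidueField k) :
    augmentation hr (algebraMap _ (FunctionReduction k r) c) = c := by
  induction c using reduction_induction with
  | h0 => simp
  | hadd x y hx hy => rw [map_add, map_add, hx, hy]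
  | h t a ha =>
    rw [algebraMap_hom ha, augmentation_hom hr (algebraMap_mem_le k r t a ha), evalZero_algebraMap]

/-- A function of size at most `t` whose value at the origin has absolute value `t` has an
invertible class in degree `t`. -/
theorem isUnit_hom (hr : ∀ i, 0 < r i) {t : Degree} {a : functions k r}
    (ha : a ∈ (functionFiltration k r).le t) (h0 : ‖evalZero r a‖ = t.val) :
    IsUnit (hom (functionFiltration k r) t a) := by
  classical
  set φ : MvPowerSeries (Fin n) k := (a : MvPowerSeries (Fin n) k) with hφ
  have hφ0 : MvPowerSeries.constantCoeff φ ≠ 0 := fun h => by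
    have : ‖MvPowerSeries.constantCoeff φ‖ = t.val := h0
    rw [h, norm_zero] at this
    exact t.val_pos.ne this
  have hle := (mem_le_iff hr).1 ha
  have hbound : ∀ I, ‖MvPowerSeries.coeff I φ⁻¹‖ * weight r I ≤ (-t).val := by
    intro I
    induction I using WellFoundedLT.induction with
    | ind I ih =>
      have h0' : ‖(MvPowerSeries.constantCoeff φ)⁻¹‖ = (-t).val := by
        rw [norm_inv, Degree.val_neg]
        exact congrArg _ h0
      rw [MvPowerSeries.coeff_inv]
      split_ifs with hI
      · rw [hI, weight_zero, mul_one, h0']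
      · rw [norm_mul, norm_neg, h0', mul_assoc]
        refine mul_le_of_le_one_right (-t).val_pos.le ?_
        rw [← le_div_iff₀ (weight_pos hr I), one_div]
        refine IsUltrametricDist.norm_sum_le_of_forall_le_of_nonneg
          (inv_nonneg.2 (weight_pos hr I).le) fun p hp => ?_
        rw [Finset.HasAntidiagonal.mem_antidiagonal] at hp
        split_ifs with hlt
        · rw [norm_mul, ← one_div, le_div_iff₀ (weight_pos hr I), ← hp, weight_add]
          calc _ = ‖MvPowerSeries.coeff p.1 φ‖ * weight r p.1 *
                (‖MvPowerSeries.coeff p.2 φ⁻¹‖ * weight r p.2) := by ring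
            _ ≤ t.val * (-t).val := mul_le_mul (hle _) (ih _ hlt)
                (mul_nonneg (norm_nonneg _) (weight_pos hr _).le) t.val_pos.le
            _ = 1 := mul_inv_cancel₀ t.val_pos.ne'
        · simpa using (weight_pos hr I).le
  set b : functions k r := ⟨φ⁻¹, mem_functions_of_bounded hr hbound⟩
  have hb : b ∈ (functionFiltration k r).le (-t) := (mem_le_iff hr).2 hbound
  have hab : a * b = 1 := Subtype.ext (MvPowerSeries.mul_inv_cancel φ hφ0)
  refine IsUnit.of_mul_eq_one (hom _ (-t) b) ?_
  rw [hom_mul ha hb, hab, add_neg_cancel, hom_one]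

variable (k) in
/-- The kernel of the augmentation. -/
noncomputable def originIdeal (hr : ∀ i, 0 < r i) : Ideal (FunctionReduction k r) :=
  RingHom.ker (augmentation hr)

theorem mem_originIdeal {hr : ∀ i, 0 < r i} {x : FunctionReduction k r} :
    x ∈ originIdeal k hr ↔ augmentation hr x = 0 := Iff.rfl

theorem originIdeal_isHomogeneous (hr : ∀ i, 0 < r i) :
    IsHomogeneousIdeal (originIdeal k hr) :=
  isHomogeneousIdeal_comap _ _ fun x hx t => by
    rw [Ideal.mem_bot] at hx ⊢
    rw [hx, DirectSum.zero_apply, map_zero]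

theorem le_originIdeal (hr : ∀ i, 0 < r i) {I : Ideal (FunctionReduction k r)}
    (hI : IsHomogeneousIdeal I) (hne : I ≠ ⊤) : I ≤ originIdeal k hr := by
  intro x hx
  rw [mem_originIdeal]
  refine DFinsupp.ext fun t => ?_
  have hxt := hI x hx t
  obtain ⟨a, ha, hax, e⟩ := exists_of_eq_hom (x t)
  rw [e] at hxt
  have h1 : augmentation hr x t = Piece.mk _ t (evalZero r a) (evalZero_mem_le hr t a ha) := by
    rw [augmentation, map_apply, ← hax]
    rfl
  rw [h1]
  refine (mk_eq_zero _).2 (mem_field_lt.2 (lt_of_le_of_ne (evalZero_mem_le hr t a ha) fun h => hne ?_))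
  exact Ideal.eq_top_of_isUnit_mem _ hxt (isUnit_hom hr ha h)

theorem isMaximalHomogeneousIdeal_iff (hr : ∀ i, 0 < r i) {m : Ideal (FunctionReduction k r)} :
    IsMaximalHomogeneousIdeal m ↔ m = originIdeal k hr := by
  have hmax : IsMaximalHomogeneousIdeal (originIdeal k hr) :=
    ⟨⟨originIdeal_isHomogeneous hr, RingHom.ker_ne_top (augmentation hr)⟩,
      fun J hJ _ => le_originIdeal hr hJ.1 hJ.2⟩
  constructor
  · intro h
    exact le_antisymm (le_originIdeal hr h.1.1 h.1.2)
      (h.2 hmax.1 (le_originIdeal hr h.1.1 h.1.2))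
  · rintro rfl
    exact hmax

/-! ### Generators of the maximal homogeneous ideal -/

/-- A function vanishing at the origin and of size at most `t` is a combination of the coordinates
with coefficients of the expected sizes. -/
theorem exists_eq_sum_coordinate (hr : ∀ i, 0 < r i) {t : Degree} {a : functions k r}
    (ha : a ∈ (functionFiltration k r).le t) (h0 : evalZero r a = 0) :
    ∃ q : Fin n → functions k r,
      (∀ j, q j ∈ (functionFiltration k r).le (t - Degree.mk (r j) (hr j))) ∧
      a = ∑ j, coordinate r j * q j := by
  classical
  have hidx : ∀ I : Fin n →₀ ℕ, ∃ j : Option (Fin n), (I ≠ 0 → ∃ i, j = some i ∧ I i ≠ 0) := by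
    intro I
    by_cases hI : I = 0
    · exact ⟨none, fun h => absurd hI h⟩
    · obtain ⟨i, hi⟩ := Finsupp.ne_iff.1 hI
      exact ⟨some i, fun _ => ⟨i, rfl, hi⟩⟩
  choose idx hidx using hidx
  let q : Fin n → MvPowerSeries (Fin n) k := fun j I =>
    if idx (I + Finsupp.single j 1) = some j then
      MvPowerSeries.coeff (I + Finsupp.single j 1) (a : MvPowerSeries (Fin n) k) else 0
  have hqc : ∀ j I, MvPowerSeries.coeff I (q j) =
      if idx (I + Finsupp.single j 1) = some j then
        MvPowerSeries.coeff (I + Finsupp.single j 1) (a : MvPowerSeries (Fin n) k) else 0 :=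
    fun _ _ => rfl
  have hq : ∀ j I, ‖MvPowerSeries.coeff I (q j)‖ * weight r I ≤
      (t - Degree.mk (r j) (hr j)).val := by
    intro j I
    rw [Degree.val_sub, Degree.val_mk, le_div_iff₀ (hr j), hqc]
    split_ifs
    · have := (mem_le_iff hr).1 ha (I + Finsupp.single j 1)
      rwa [weight_add, weight_single, ← mul_assoc] at this
    · simpa using t.val_pos.le
  refine ⟨fun j => ⟨q j, mem_functions_of_bounded hr (hq j)⟩, fun j => (mem_le_iff hr).2 (hq j),
    Subtype.ext (MvPowerSeries.ext fun I => ?_)⟩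
  rw [AddSubmonoidClass.coe_finsetSum, map_sum]
  have hterm : ∀ j, MvPowerSeries.coeff I (MvPowerSeries.X j * q j) =
      if I ≠ 0 ∧ idx I = some j then MvPowerSeries.coeff I (a : MvPowerSeries (Fin n) k) else 0 := by
    intro j
    rw [MvPowerSeries.X, MvPowerSeries.coeff_monomial_mul, one_mul, hqc]
    by_cases hj : Finsupp.single j 1 ≤ I
    · rw [if_pos hj, tsub_add_cancel_of_le hj]
      have : I ≠ 0 := by
        rintro rfl
        have := hj j
        simp at this
      simp [this]
    · rw [if_neg hj, if_neg]
      rintro ⟨hI, hij⟩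
      obtain ⟨i, hi, hIi⟩ := hidx I hI
      rw [hij, Option.some.injEq] at hi
      exact hj (Finsupp.single_le_iff.2 (hi ▸ Nat.one_le_iff_ne_zero.2 hIi))
  calc MvPowerSeries.coeff I (a : MvPowerSeries (Fin n) k)
      = ∑ j, if I ≠ 0 ∧ idx I = some j then
        MvPowerSeries.coeff I (a : MvPowerSeries (Fin n) k) else 0 := by
        by_cases hI : I = 0
        · subst hI
          rw [evalZero_apply] at h0
          simp [h0]
        · obtain ⟨i, hi, -⟩ := hidx I hI
          simp [hI, hi]
    _ = _ := Finset.sum_congr rfl fun j _ => (hterm j).symm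

theorem hom_coordinate_mem (hr : ∀ i, 0 < r i) (i : Fin n) :
    hom (functionFiltration k r) (Degree.mk (r i) (hr i)) (coordinate r i) ∈
      originIdeal k hr := by
  rw [mem_originIdeal, augmentation_hom hr (coordinate_mem_le hr i)]
  have : evalZero r (coordinate (k := k) r i) = 0 := MvPowerSeries.constantCoeff_X i
  rw [this, hom_zero]

theorem hom_decomposition (hr : ∀ i, 0 < r i) {t : Degree} {a : functions k r}
    (ha : a ∈ (functionFiltration k r).le t) :
    hom (functionFiltration k r) t a - algebraMap (GradedResidueField k) _
      (hom (fieldFiltration k) t (evalZero r a)) ∈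
      Ideal.span (Set.range fun i =>
        hom (functionFiltration k r) (Degree.mk (r i) (hr i)) (coordinate r i)) := by
  have ha0 := evalZero_mem_le hr t a ha
  have hc := algebraMap_mem_le k r t _ ha0
  have hd := (functionFiltration k r).le t |>.sub_mem ha hc
  have hd0 : evalZero r (a - algebraMap k (functions k r) (evalZero r a)) = 0 := by
    rw [map_sub, evalZero_algebraMap, sub_self]
  obtain ⟨q, hq, e⟩ := exists_eq_sum_coordinate hr hd hd0
  have h1 : hom (functionFiltration k r) t a =
      hom _ t (a - algebraMap k (functions k r) (evalZero r a)) +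
        hom _ t (algebraMap k (functions k r) (evalZero r a)) := by
    rw [← hom_add hd hc, sub_add_cancel]
  have h2 : ∀ j, hom (functionFiltration k r) t (coordinate r j * q j) =
      hom _ (Degree.mk (r j) (hr j)) (coordinate r j) * hom _ (t - Degree.mk (r j) (hr j)) (q j) := by
    intro j
    rw [hom_mul (coordinate_mem_le hr j) (hq j), add_sub_cancel]
  have h3 : ∀ j, coordinate r j * q j ∈ (functionFiltration k r).le t := by
    intro j
    have := (functionFiltration k r).mul_mem (coordinate_mem_le hr j) (hq j)
    rwa [add_sub_cancel] at this
  rw [h1, algebraMap_hom ha0, add_sub_cancel_right, e, hom_sum _ fun j _ => h3 j]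
  refine Ideal.sum_mem _ fun j _ => ?_
  rw [h2]
  exact Ideal.mul_mem_right _ _ (Ideal.subset_span ⟨j, rfl⟩)

theorem sub_algebraMap_mem_span (hr : ∀ i, 0 < r i) (x : FunctionReduction k r) :
    x - algebraMap (GradedResidueField k) _ (augmentation hr x) ∈
      Ideal.span (Set.range fun i =>
        hom (functionFiltration k r) (Degree.mk (r i) (hr i)) (coordinate r i)) := by
  induction x using reduction_induction with
  | h0 => simp
  | hadd x y hx hy =>
    rw [map_add, map_add, add_sub_add_comm]
    exact Ideal.add_mem _ hx hy
  | h t a ha =>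
    rw [augmentation_hom hr ha]
    exact hom_decomposition hr ha

theorem span_coordinates (hr : ∀ i, 0 < r i) :
    Ideal.span (Set.range fun i =>
      hom (functionFiltration k r) (Degree.mk (r i) (hr i)) (coordinate r i)) =
      originIdeal k hr := by
  refine le_antisymm (Ideal.span_le.2 ?_) fun x hx => ?_
  · rintro _ ⟨i, rfl⟩
    exact hom_coordinate_mem hr i
  · have := sub_algebraMap_mem_span hr x
    rwa [mem_originIdeal.1 hx, map_zero, sub_zero] at this

/-! ### Linear coefficients and the cotangent space -/

/-- The coefficient of a function along the `l`-th coordinate. -/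
noncomputable def slope (l : Fin n) : functions k r →+ k :=
  (MvPowerSeries.coeff (Finsupp.single l 1)).toAddMonoidHom.comp
    (functions k r).subtype.toAddMonoidHom

theorem slope_apply (l : Fin n) (a : functions k r) : slope l a =
    MvPowerSeries.coeff (Finsupp.single l 1) (a : MvPowerSeries (Fin n) k) := rfl

theorem slope_mem_le (hr : ∀ i, 0 < r i) {t : Degree} {a : functions k r}
    (ha : a ∈ (functionFiltration k r).le t) (l : Fin n) :
    slope l a ∈ (fieldFiltration k).le (t - Degree.mk (r l) (hr l)) := by
  have := (mem_le_iff hr).1 ha (Finsupp.single l 1)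
  rw [weight_single, ← le_div_iff₀ (hr l)] at this
  rwa [mem_field_le, Degree.val_sub]

theorem slope_mem_lt (hr : ∀ i, 0 < r i) {t : Degree} {a : functions k r}
    (ha : a ∈ (functionFiltration k r).lt t) (l : Fin n) :
    slope l a ∈ (fieldFiltration k).lt (t - Degree.mk (r l) (hr l)) := by
  have := (mem_lt_iff hr).1 ha (Finsupp.single l 1)
  rw [weight_single, ← lt_div_iff₀ (hr l)] at this
  rwa [mem_field_lt, Degree.val_sub]

/-- The additive map sending a homogeneous element to the class of its coefficient along the
`l`-th coordinate. -/
noncomputable def linearCoeff (hr : ∀ i, 0 < r i) (l : Fin n) :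
    FunctionReduction k r →+ GradedResidueField k :=
  mapAdd (slope l) (fun t => t - Degree.mk (r l) (hr l)) (fun _ _ ha => slope_mem_le hr ha l)
    (fun _ _ ha => slope_mem_lt hr ha l)

theorem linearCoeff_hom (hr : ∀ i, 0 < r i) (l : Fin n) {t : Degree} {a : functions k r}
    (ha : a ∈ (functionFiltration k r).le t) :
    linearCoeff hr l (hom _ t a) =
      hom (fieldFiltration k) (t - Degree.mk (r l) (hr l)) (slope l a) := mapAdd_hom _ _ _ _ ha

theorem slope_mul (l : Fin n) (a b : functions k r) :
    slope l (a * b) = evalZero r a * slope l b + evalZero r b * slope l a := by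
  classical
  change MvPowerSeries.coeff (Finsupp.single l 1)
    ((a : MvPowerSeries (Fin n) k) * (b : MvPowerSeries (Fin n) k)) = _
  rw [MvPowerSeries.coeff_mul, Finsupp.antidiagonal_single, Finset.sum_map]
  simp [Finset.Nat.antidiagonal_succ, slope_apply, evalZero, mul_comm]

theorem linearCoeff_mul (hr : ∀ i, 0 < r i) (l : Fin n) (x y : FunctionReduction k r) :
    linearCoeff hr l (x * y) =
      augmentation hr x * linearCoeff hr l y + augmentation hr y * linearCoeff hr l x := by
  induction x using reduction_induction with
  | h0 => simp
  | hadd x x' hx hx' => rw [add_mul, map_add, hx, hx', map_add, map_add]; ring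
  | h s a ha =>
    induction y using reduction_induction with
    | h0 => simp
    | hadd y y' hy hy' => rw [mul_add, map_add, hy, hy', map_add, map_add]; ring
    | h t b hb =>
      have ha0 := evalZero_mem_le hr _ _ ha
      have hb0 := evalZero_mem_le hr _ _ hb
      have hal := slope_mem_le hr ha l
      have hbl := slope_mem_le hr hb l
      have e1 : s + (t - Degree.mk (r l) (hr l)) = s + t - Degree.mk (r l) (hr l) :=
        (add_sub_assoc _ _ _).symm
      have e2 : t + (s - Degree.mk (r l) (hr l)) = s + t - Degree.mk (r l) (hr l) := by
        rw [← add_sub_assoc, add_comm]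
      have h1 := (fieldFiltration k).mul_mem ha0 hbl
      have h2 := (fieldFiltration k).mul_mem hb0 hal
      rw [e1] at h1
      rw [e2] at h2
      rw [hom_mul ha hb, linearCoeff_hom hr l (Filtration.mul_mem _ ha hb), linearCoeff_hom hr l ha,
        linearCoeff_hom hr l hb, augmentation_hom hr ha, augmentation_hom hr hb,
        hom_mul ha0 hbl, hom_mul hb0 hal, e1, e2, ← hom_add h1 h2, slope_mul]

theorem linearCoeff_algebraMap (hr : ∀ i, 0 < r i) (l : Fin n) (c : GradedResidueField k) :
    linearCoeff hr l (algebraMap _ (FunctionReduction k r) c) = 0 := by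
  classical
  induction c using reduction_induction with
  | h0 => simp
  | hadd x y hx hy => rw [map_add, map_add, hx, hy, add_zero]
  | h t a ha =>
    rw [algebraMap_hom ha, linearCoeff_hom hr l (algebraMap_mem_le k r t a ha)]
    have : slope l (algebraMap k (functions k r) a) = 0 := by
      refine (MvPowerSeries.coeff_C (σ := Fin n) (Finsupp.single l 1) a).trans ?_
      simp
    rw [this, hom_zero]

theorem linearCoeff_coordinate (hr : ∀ i, 0 < r i) (l j : Fin n) :
    linearCoeff hr l (hom (functionFiltration k r) (Degree.mk (r j) (hr j)) (coordinate r j)) =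
      if l = j then 1 else 0 := by
  classical
  rw [linearCoeff_hom hr l (coordinate_mem_le hr j)]
  have : slope l (coordinate (k := k) r j) = if l = j then 1 else 0 := by
    refine (MvPowerSeries.coeff_X (Finsupp.single l 1) j).trans ?_
    simp [Finsupp.single_left_inj]
  rw [this]
  split_ifs with h
  · rw [h, sub_self, hom_one]
  · rw [hom_zero]

end Reduction

section Substitution

variable {k : Type*} [NormedField k] [IsUltrametricDist k] {n : ℕ} {ρ σ : Fin n → ℝ}

theorem eq_of_forall_gauss_sub_le (hρ : ∀ i, 0 < ρ i) {f g : MvPowerSeries (Fin n) k}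
    (hf : f ∈ tateAlgebra k ρ) (hg : g ∈ tateAlgebra k ρ) {C : ℝ}
    (h : ∀ ε : ℝ, 0 < ε → gauss ρ (f - g) ≤ C * ε) : f = g := by
  have h0 : gauss ρ (f - g) ≤ 0 := by
    have : Tendsto (fun ε : ℝ => C * ε) (𝓝[>] 0) (𝓝 0) := by
      refine Tendsto.mono_left ?_ nhdsWithin_le_nhds
      simpa using (by fun_prop : Continuous fun ε : ℝ => C * ε).tendsto 0
    exact ge_of_tendsto this (eventually_mem_nhdsWithin.mono fun ε hε => h ε hε)
  exact sub_eq_zero.1 ((gauss_eq_zero hρ (sub_mem hf hg)).1 (le_antisymm h0 (gauss_nonneg _)))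

theorem gauss_pow (hρ : ∀ i, 0 < ρ i) {f : MvPowerSeries (Fin n) k} (hf : f ∈ tateAlgebra k ρ)
    (m : ℕ) : gauss ρ (f ^ m) = gauss ρ f ^ m := by
  induction m with
  | zero => simp [gauss_one hρ]
  | succ m ih => rw [pow_succ, gauss_mul hρ (pow_mem hf m) hf, ih, pow_succ]

theorem gauss_prod (hρ : ∀ i, 0 < ρ i) {ι : Type*} (S : Finset ι)
    {f : ι → MvPowerSeries (Fin n) k} (hf : ∀ i, f i ∈ tateAlgebra k ρ) :
    gauss ρ (∏ i ∈ S, f i) = ∏ i ∈ S, gauss ρ (f i) := by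
  classical
  induction S using Finset.induction_on with
  | empty => simp [gauss_one hρ]
  | insert i S hi ih =>
    rw [Finset.prod_insert hi, Finset.prod_insert hi, gauss_mul hρ (hf i) (prod_mem fun i _ => hf i),
      ih]

/-- The monomial `g ^ I` in a family of power series. -/
noncomputable def monomialIn (g : Fin n → MvPowerSeries (Fin n) k) (I : Fin n →₀ ℕ) :
    MvPowerSeries (Fin n) k := ∏ i, g i ^ I i

theorem monomialIn_mem {g : Fin n → MvPowerSeries (Fin n) k} (hg : ∀ i, g i ∈ tateAlgebra k ρ)
    (I : Fin n →₀ ℕ) : monomialIn g I ∈ tateAlgebra k ρ :=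
  prod_mem fun i _ => pow_mem (hg i) _

theorem gauss_monomialIn_le (hρ : ∀ i, 0 < ρ i) {g : Fin n → MvPowerSeries (Fin n) k}
    (hg : ∀ i, g i ∈ tateAlgebra k ρ) (hgσ : ∀ i, gauss ρ (g i) ≤ σ i) (I : Fin n →₀ ℕ) :
    gauss ρ (monomialIn g I) ≤ weight σ I := by
  rw [monomialIn, gauss_prod hρ _ fun i => pow_mem (hg i) _, weight_eq_prod]
  refine Finset.prod_le_prod (fun i _ => gauss_nonneg _) fun i _ => ?_
  rw [gauss_pow hρ (hg i)]
  exact pow_le_pow_left₀ (gauss_nonneg _) (hgσ i) _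

/-- The terms of the power series obtained by substitution. -/
noncomputable def substTerm (g : Fin n → MvPowerSeries (Fin n) k) (h : MvPowerSeries (Fin n) k)
    (I : Fin n →₀ ℕ) : MvPowerSeries (Fin n) k :=
  MvPowerSeries.C (MvPowerSeries.coeff I h) * monomialIn g I

/-- Substitution of power series of Gauss norm at most `σ i` into a power series which converges
on the closed polydisc of polyradius `σ`. -/
noncomputable def substitute (g : Fin n → MvPowerSeries (Fin n) k) (h : MvPowerSeries (Fin n) k) :
    MvPowerSeries (Fin n) k := seriesSum (substTerm g h)

variable {g : Fin n → MvPowerSeries (Fin n) k}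

theorem substitute_coe (P : MvPolynomial (Fin n) k) :
    substitute g (P : MvPowerSeries (Fin n) k) = MvPolynomial.aeval g P := by
  ext I
  rw [substitute, coeff_seriesSum, tsum_eq_sum (s := P.support), ← map_sum,
    MvPolynomial.aeval_def, MvPolynomial.eval₂_eq']
  · rfl
  · intro J hJ
    rw [substTerm, MvPolynomial.coeff_coe, MvPolynomial.notMem_support_iff.1 hJ]
    simp

theorem substTerm_mem (hg : ∀ i, g i ∈ tateAlgebra k ρ) (h : MvPowerSeries (Fin n) k)
    (I : Fin n →₀ ℕ) : substTerm g h I ∈ tateAlgebra k ρ :=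
  mul_mem (C_mem_tateAlgebra _) (monomialIn_mem hg I)

theorem gauss_substTerm_le (hρ : ∀ i, 0 < ρ i) (hg : ∀ i, g i ∈ tateAlgebra k ρ)
    (hgσ : ∀ i, gauss ρ (g i) ≤ σ i) (h : MvPowerSeries (Fin n) k) (I : Fin n →₀ ℕ) :
    gauss ρ (substTerm g h I) ≤ ‖MvPowerSeries.coeff I h‖ * weight σ I := by
  rw [substTerm, gauss_mul hρ (C_mem_tateAlgebra _) (monomialIn_mem hg I), gauss_C hρ]
  exact mul_le_mul_of_nonneg_left (gauss_monomialIn_le hρ hg hgσ I) (norm_nonneg _)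

theorem tendsto_gauss_substTerm (hρ : ∀ i, 0 < ρ i) (hg : ∀ i, g i ∈ tateAlgebra k ρ)
    (hgσ : ∀ i, gauss ρ (g i) ≤ σ i) {h : MvPowerSeries (Fin n) k} (hh : h ∈ tateAlgebra k σ) :
    Tendsto (fun I => gauss ρ (substTerm g h I)) cofinite (𝓝 0) :=
  squeeze_zero (fun _ => gauss_nonneg _) (gauss_substTerm_le hρ hg hgσ h) (mem_tateAlgebra.1 hh)

variable [CompleteSpace k]

theorem substitute_mem (hρ : ∀ i, 0 < ρ i) (hg : ∀ i, g i ∈ tateAlgebra k ρ)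
    (hgσ : ∀ i, gauss ρ (g i) ≤ σ i) {h : MvPowerSeries (Fin n) k} (hh : h ∈ tateAlgebra k σ) :
    substitute g h ∈ tateAlgebra k ρ :=
  seriesSum_mem hρ (substTerm_mem hg h) (tendsto_gauss_substTerm hρ hg hgσ hh)

theorem gauss_substitute_le (hρ : ∀ i, 0 < ρ i) (hg : ∀ i, g i ∈ tateAlgebra k ρ)
    (hgσ : ∀ i, gauss ρ (g i) ≤ σ i) {h : MvPowerSeries (Fin n) k} (hh : h ∈ tateAlgebra k σ) :
    gauss ρ (substitute g h) ≤ gauss σ h :=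
  gauss_seriesSum_le hρ (substTerm_mem hg h) (tendsto_gauss_substTerm hρ hg hgσ hh)
    (gauss_nonneg _) fun I => (gauss_substTerm_le hρ hg hgσ h I).trans (le_gauss hh I)

theorem substitute_add (hρ : ∀ i, 0 < ρ i) (hg : ∀ i, g i ∈ tateAlgebra k ρ)
    (hgσ : ∀ i, gauss ρ (g i) ≤ σ i) {h h' : MvPowerSeries (Fin n) k} (hh : h ∈ tateAlgebra k σ)
    (hh' : h' ∈ tateAlgebra k σ) : substitute g (h + h') = substitute g h + substitute g h' := by
  ext I
  have h1 := summable_coeff hρ (substTerm_mem hg h) (tendsto_gauss_substTerm hρ hg hgσ hh) I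
  have h2 := summable_coeff hρ (substTerm_mem hg h') (tendsto_gauss_substTerm hρ hg hgσ hh') I
  rw [map_add, substitute, substitute, substitute, coeff_seriesSum, coeff_seriesSum,
    coeff_seriesSum, ← h1.tsum_add h2]
  refine tsum_congr fun J => ?_
  rw [← map_add, substTerm, substTerm, substTerm, map_add, map_add, add_mul]

theorem substitute_sub (hρ : ∀ i, 0 < ρ i) (hg : ∀ i, g i ∈ tateAlgebra k ρ)
    (hgσ : ∀ i, gauss ρ (g i) ≤ σ i) {h h' : MvPowerSeries (Fin n) k} (hh : h ∈ tateAlgebra k σ)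
    (hh' : h' ∈ tateAlgebra k σ) : substitute g (h - h') = substitute g h - substitute g h' := by
  rw [eq_sub_iff_add_eq, ← substitute_add hρ hg hgσ (sub_mem hh hh') hh', sub_add_cancel]

theorem substitute_mul_aux (hρ : ∀ i, 0 < ρ i) (hσ : ∀ i, 0 < σ i)
    (hg : ∀ i, g i ∈ tateAlgebra k ρ)
    (hgσ : ∀ i, gauss ρ (g i) ≤ σ i) {h h' : MvPowerSeries (Fin n) k} (hh : h ∈ tateAlgebra k σ)
    (hh' : h' ∈ tateAlgebra k σ)
    (H : ∀ Q : MvPolynomial (Fin n) k, substitute g (h * Q) = substitute g h * substitute g Q) :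
    substitute g (h * h') = substitute g h * substitute g h' := by
  have hS := substitute_mem hρ hg hgσ hh
  refine eq_of_forall_gauss_sub_le hρ (substitute_mem hρ hg hgσ (mul_mem hh hh'))
    (mul_mem hS (substitute_mem hρ hg hgσ hh')) (C := gauss σ h) fun ε hε => ?_
  obtain ⟨F, hF⟩ := exists_truncation hh' hε
  set Q := truncation F h'
  have hQ : (Q : MvPowerSeries (Fin n) k) ∈ tateAlgebra k σ := coe_mem_tateAlgebra Q
  have hd := sub_mem hh' hQ
  have e : substitute g (h * h') - substitute g h * substitute g h' =
      substitute g (h * (h' - (Q : MvPowerSeries (Fin n) k))) -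
        substitute g h * substitute g (h' - (Q : MvPowerSeries (Fin n) k)) := by
    rw [mul_sub, substitute_sub hρ hg hgσ (mul_mem hh hh') (mul_mem hh hQ),
      substitute_sub hρ hg hgσ hh' hQ, H]
    ring
  rw [e]
  refine (gauss_sub_le hρ (substitute_mem hρ hg hgσ (mul_mem hh hd))
    (mul_mem hS (substitute_mem hρ hg hgσ hd))).trans (max_le ?_ ?_)
  · refine (gauss_substitute_le hρ hg hgσ (mul_mem hh hd)).trans ?_
    rw [gauss_mul hσ hh hd]
    exact mul_le_mul_of_nonneg_left hF (gauss_nonneg _)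
  · rw [gauss_mul hρ hS (substitute_mem hρ hg hgσ hd)]
    exact mul_le_mul (gauss_substitute_le hρ hg hgσ hh)
      ((gauss_substitute_le hρ hg hgσ hd).trans hF) (gauss_nonneg _) (gauss_nonneg _)

theorem substitute_mul (hρ : ∀ i, 0 < ρ i) (hσ : ∀ i, 0 < σ i)
    (hg : ∀ i, g i ∈ tateAlgebra k ρ)
    (hgσ : ∀ i, gauss ρ (g i) ≤ σ i) {h h' : MvPowerSeries (Fin n) k} (hh : h ∈ tateAlgebra k σ)
    (hh' : h' ∈ tateAlgebra k σ) :
    substitute g (h * h') = substitute g h * substitute g h' := by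
  refine substitute_mul_aux hρ hσ hg hgσ hh hh' fun Q => ?_
  rw [mul_comm, mul_comm (substitute g h)]
  refine substitute_mul_aux hρ hσ hg hgσ (coe_mem_tateAlgebra Q) hh fun P => ?_
  rw [← MvPolynomial.coe_mul, substitute_coe, substitute_coe, substitute_coe, map_mul]

/-- Substitution as a morphism of Tate algebras. -/
noncomputable def substHom (hρ : ∀ i, 0 < ρ i) (hσ : ∀ i, 0 < σ i)
    (hg : ∀ i, g i ∈ tateAlgebra k ρ) (hgσ : ∀ i, gauss ρ (g i) ≤ σ i) :
    tateAlgebra k σ →ₐ[k] tateAlgebra k ρ where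
  toFun h := ⟨substitute g h, substitute_mem hρ hg hgσ h.2⟩
  map_zero' := Subtype.ext <| by
    simpa using substitute_coe (g := g) 0
  map_one' := Subtype.ext <| by
    simpa using substitute_coe (g := g) 1
  map_add' h h' := Subtype.ext (substitute_add hρ hg hgσ h.2 h'.2)
  map_mul' h h' := Subtype.ext (substitute_mul hρ hσ hg hgσ h.2 h'.2)
  commutes' c := Subtype.ext <| by
    have := substitute_coe (g := g) (MvPolynomial.C c)
    rw [MvPolynomial.coe_C, MvPolynomial.aeval_C] at this
    exact this

theorem substitute_X (i : Fin n) : substitute g (MvPowerSeries.X i) = g i := by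
  simpa using substitute_coe (g := g) (MvPolynomial.X i)

theorem substitute_C (c : k) : substitute g (MvPowerSeries.C c) = MvPowerSeries.C c := by
  have := substitute_coe (g := g) (MvPolynomial.C c)
  rwa [MvPolynomial.coe_C, MvPolynomial.aeval_C] at this

end Substitution

section Perturbation

variable {k : Type*} [NormedField k] [IsUltrametricDist k] {n : ℕ} {ρ σ : Fin n → ℝ}

/-- The Gauss norm on a Tate algebra. -/
noncomputable abbrev tnorm (h : tateAlgebra k ρ) : ℝ := gauss ρ (h : MvPowerSeries (Fin n) k)

/-- The `i`-th coordinate in a Tate algebra. -/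
noncomputable def tateX (ρ : Fin n → ℝ) (i : Fin n) : tateAlgebra k ρ :=
  ⟨MvPowerSeries.X i, X_mem_tateAlgebra i⟩

/-- A contracting endomorphism of a Tate algebra which moves the coordinates by a factor at most
`κ` moves every element by a factor at most `κ`. -/
theorem tnorm_sub_le (hρ : ∀ i, 0 < ρ i) (θ : tateAlgebra k ρ →ₐ[k] tateAlgebra k ρ)
    (hθ : ∀ h, tnorm (θ h) ≤ tnorm h) {κ : ℝ} (hκ : 0 ≤ κ)
    (hX : ∀ i, tnorm (θ (tateX ρ i) - tateX ρ i) ≤ κ * ρ i) (h : tateAlgebra k ρ) :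
    tnorm (θ h - h) ≤ κ * tnorm h := by
  have hmul : ∀ f g : tateAlgebra k ρ, tnorm (θ f - f) ≤ κ * tnorm f →
      tnorm (θ g - g) ≤ κ * tnorm g → tnorm (θ (f * g) - f * g) ≤ κ * tnorm (f * g) := by
    intro f g hf hg
    have e : θ (f * g) - f * g = θ f * (θ g - g) + (θ f - f) * g := by
      rw [map_mul]
      ring
    have h1 : tnorm (θ f * (θ g - g)) ≤ κ * tnorm (f * g) := by
      refine (gauss_mul hρ (θ f).2 (θ g - g).2).trans_le ?_
      rw [show tnorm (f * g) = tnorm f * tnorm g from gauss_mul hρ f.2 g.2]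
      calc _ ≤ tnorm f * (κ * tnorm g) := mul_le_mul (hθ f) hg (gauss_nonneg _) (gauss_nonneg _)
        _ = _ := by ring
    have h2 : tnorm ((θ f - f) * g) ≤ κ * tnorm (f * g) := by
      refine (gauss_mul hρ (θ f - f).2 g.2).trans_le ?_
      rw [show tnorm (f * g) = tnorm f * tnorm g from gauss_mul hρ f.2 g.2, ← mul_assoc]
      exact mul_le_mul_of_nonneg_right hf (gauss_nonneg _)
    rw [e]
    exact (gauss_add_le hρ (θ f * (θ g - g)).2 ((θ f - f) * g).2).trans (max_le h1 h2)
  have hconst : ∀ c : k, tnorm (θ (algebraMap k _ c) - algebraMap k _ c) ≤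
      κ * tnorm (algebraMap k (tateAlgebra k ρ) c) := by
    intro c
    rw [AlgHom.commutes, sub_self]
    exact gauss_zero.trans_le (mul_nonneg hκ (gauss_nonneg _))
  have hXp : ∀ i, tnorm (θ (tateX ρ i) - tateX ρ i) ≤ κ * tnorm (tateX (k := k) ρ i) := by
    intro i
    rw [show tnorm (tateX (k := k) ρ i) = ρ i from gauss_X hρ i]
    exact hX i
  have hmono : ∀ (I : Fin n →₀ ℕ) (c : k), tnorm (θ (MvPolynomial.aeval (tateX ρ)
      (MvPolynomial.monomial I c)) - MvPolynomial.aeval (tateX ρ) (MvPolynomial.monomial I c)) ≤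
      κ * tnorm (MvPolynomial.aeval (tateX (k := k) ρ) (MvPolynomial.monomial I c)) := by
    intro I c
    induction I using Finsupp.induction_linear generalizing c with
    | zero => simpa [← MvPolynomial.C_apply] using hconst c
    | add I J hI hJ =>
      rw [show MvPolynomial.monomial (I + J) c =
        MvPolynomial.monomial I c * MvPolynomial.monomial J 1 by simp, map_mul]
      exact hmul _ _ (hI c) (hJ 1)
    | single i m =>
      rw [← MvPolynomial.C_mul_X_pow_eq_monomial, map_mul, map_pow, MvPolynomial.aeval_C,
        MvPolynomial.aeval_X]
      refine hmul _ _ (hconst c) ?_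
      induction m with
      | zero => simpa using hconst 1
      | succ m ih =>
        rw [pow_succ]
        exact hmul _ _ ih (hXp i)
  have hcoe : ∀ P : MvPolynomial (Fin n) k, ((MvPolynomial.aeval (tateX ρ) P : tateAlgebra k ρ) :
      MvPowerSeries (Fin n) k) = P := by
    intro P
    have : (tateAlgebra k ρ).val.comp (MvPolynomial.aeval (tateX ρ)) =
        MvPolynomial.coeToMvPowerSeries.algHom k := by
      refine MvPolynomial.algHom_ext fun i => ?_
      simp [tateX]
    simpa using DFunLike.congr_fun this P
  have hkey : ∀ F : Finset (Fin n →₀ ℕ), ∀ p : tateAlgebra k ρ,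
      p = MvPolynomial.aeval (tateX ρ) (truncation F (h : MvPowerSeries (Fin n) k)) →
      tnorm (θ p - p) ≤ κ * tnorm h := by
    rintro F p rfl
    rw [truncation, map_sum, map_sum, ← Finset.sum_sub_distrib]
    unfold tnorm
    rw [AddSubmonoidClass.coe_finsetSum]
    refine gauss_sum_le hρ F (fun I _ => Subtype.prop _) (mul_nonneg hκ (gauss_nonneg _)) ?_
    intro I _
    refine (hmono I _).trans (mul_le_mul_of_nonneg_left ?_ hκ)
    unfold tnorm
    rw [hcoe, MvPolynomial.coe_monomial, gauss_monomial hρ]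
    exact le_gauss h.2 I
  refine le_of_forall_pos_le_add fun ε hε => ?_
  obtain ⟨F, hF⟩ := exists_truncation h.2 hε
  set p : tateAlgebra k ρ :=
    MvPolynomial.aeval (tateX ρ) (truncation F (h : MvPowerSeries (Fin n) k)) with hp
  have hd : tnorm (h - p) ≤ ε := by
    refine le_trans (le_of_eq ?_) hF
    rw [← hcoe]
    rfl
  have e : θ h - h = (θ (h - p) - (h - p)) + (θ p - p) := by
    rw [map_sub]
    ring
  have h1 : tnorm (θ (h - p) - (h - p)) ≤ ε :=
    (gauss_sub_le hρ (θ (h - p)).2 (h - p).2).trans (max_le ((hθ _).trans hd) hd)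
  rw [e]
  refine (gauss_add_le hρ (θ (h - p) - (h - p)).2 (θ p - p).2).trans (max_le ?_ ?_)
  · exact h1.trans (le_add_of_nonneg_left (mul_nonneg hκ (gauss_nonneg _)))
  · exact (hkey F p hp).trans (le_add_of_nonneg_right hε.le)

/-- A contracting endomorphism close to the identity is surjective. -/
theorem surjective_of_tnorm_sub_le [CompleteSpace k] (hρ : ∀ i, 0 < ρ i)
    (θ : tateAlgebra k ρ →ₐ[k] tateAlgebra k ρ)
    (hθ : ∀ h, tnorm (θ h) ≤ tnorm h) {κ : ℝ} (hκ : 0 ≤ κ) (hκ1 : κ < 1)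
    (H : ∀ h, tnorm (θ h - h) ≤ κ * tnorm h) : Function.Surjective θ := by
  intro y
  let E : tateAlgebra k ρ → tateAlgebra k ρ := fun h => h - θ h
  have hE : ∀ h, tnorm (E h) ≤ κ * tnorm h := fun h => by
    change gauss ρ ((h - θ h : tateAlgebra k ρ) : MvPowerSeries (Fin n) k) ≤ _
    rw [← neg_sub (θ h) h, NegMemClass.coe_neg, gauss_neg]
    exact H h
  let u : ℕ → tateAlgebra k ρ := fun j => E^[j] y
  have hu : ∀ j, tnorm (u j) ≤ κ ^ j * tnorm y := by
    intro j
    induction j with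
    | zero => simp [u]
    | succ j ih =>
      have : u (j + 1) = E (u j) := Function.iterate_succ_apply' E j y
      rw [this, pow_succ', mul_assoc]
      exact (hE _).trans (mul_le_mul_of_nonneg_left ih hκ)
  have hlim : Tendsto (fun j => tnorm (u j)) cofinite (𝓝 0) := by
    rw [Nat.cofinite_eq_atTop]
    exact squeeze_zero (fun _ => gauss_nonneg _) hu
      (by simpa using (tendsto_pow_atTop_nhds_zero_of_lt_one hκ hκ1).mul_const (tnorm y))
  have hpart : ∀ N, θ (∑ j ∈ Finset.range N, u j) = y - u N := by
    intro N
    induction N with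
    | zero => simp [u]
    | succ N ih =>
      have : u (N + 1) = u N - θ (u N) := Function.iterate_succ_apply' E N y
      rw [Finset.sum_range_succ, map_add, ih, this]
      ring
  let z : tateAlgebra k ρ :=
    ⟨seriesSum fun j => (u j : MvPowerSeries (Fin n) k), seriesSum_mem hρ (fun j => (u j).2) hlim⟩
  refine ⟨z, sub_eq_zero.1 (Subtype.ext ?_)⟩
  rw [ZeroMemClass.coe_zero, ← gauss_eq_zero hρ (θ z - y).2]
  refine le_antisymm ?_ (gauss_nonneg _)
  have hbound : ∀ N, tnorm (θ z - y) ≤ κ ^ N * tnorm y := by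
    intro N
    have hz : tnorm (z - ∑ j ∈ Finset.range N, u j) ≤ κ ^ N * tnorm y := by
      have := gauss_seriesSum_sub_le hρ (fun j => (u j).2) hlim (Finset.range N)
        (mul_nonneg (pow_nonneg hκ N) (gauss_nonneg (ρ := ρ) (y : MvPowerSeries (Fin n) k)))
        fun j hj => (hu j).trans (mul_le_mul_of_nonneg_right
          (pow_le_pow_of_le_one hκ hκ1.le (by simpa using hj)) (gauss_nonneg _))
      unfold tnorm
      rwa [AddSubgroupClass.coe_sub, AddSubmonoidClass.coe_finsetSum]
    have e : θ z - y = θ (z - ∑ j ∈ Finset.range N, u j) - u N := by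
      rw [map_sub, hpart]
      ring
    rw [e]
    exact (gauss_sub_le hρ (θ _).2 (u N).2).trans (max_le ((hθ _).trans hz) (hu N))
  exact ge_of_tendsto' (by
    simpa using (tendsto_pow_atTop_nhds_zero_of_lt_one hκ hκ1).mul_const (tnorm y)) hbound

theorem tnorm_le_of_tnorm_sub_le (hρ : ∀ i, 0 < ρ i)
    (θ : tateAlgebra k ρ →ₐ[k] tateAlgebra k ρ) {κ : ℝ} (hκ1 : κ < 1)
    (H : ∀ h, tnorm (θ h - h) ≤ κ * tnorm h) (h : tateAlgebra k ρ) : tnorm h ≤ tnorm (θ h) := by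
  have e : h = θ h - (θ h - h) := by ring
  have h1 : tnorm h ≤ max (tnorm (θ h)) (tnorm (θ h - h)) := by
    conv_lhs => rw [e]
    exact gauss_sub_le hρ (θ h).2 (θ h - h).2
  rcases le_max_iff.1 h1 with h2 | h2
  · exact h2
  · have h3 := h2.trans (H h)
    have h4 : 0 ≤ tnorm h := gauss_nonneg _
    have h5 : tnorm h = 0 := by nlinarith
    rw [h5]
    exact gauss_nonneg _

/-- Two contracting morphisms of Tate algebras which are inverse to each other on the coordinates
up to a factor less than `1` are isometric and bijective. -/
theorem bijective_of_almost_inverse [CompleteSpace k] (hρ : ∀ i, 0 < ρ i) (hσ : ∀ i, 0 < σ i)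
    (Φ : tateAlgebra k σ →ₐ[k] tateAlgebra k ρ) (Ψ : tateAlgebra k ρ →ₐ[k] tateAlgebra k σ)
    (hΦ : ∀ h, tnorm (Φ h) ≤ tnorm h) (hΨ : ∀ h, tnorm (Ψ h) ≤ tnorm h) {κ : ℝ} (hκ : 0 ≤ κ)
    (hκ1 : κ < 1) (hΨΦ : ∀ i, tnorm (Ψ (Φ (tateX σ i)) - tateX σ i) ≤ κ * σ i)
    (hΦΨ : ∀ i, tnorm (Φ (Ψ (tateX ρ i)) - tateX ρ i) ≤ κ * ρ i) :
    Function.Bijective Φ ∧ ∀ h, tnorm (Φ h) = tnorm h := by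
  have h1 := tnorm_sub_le hσ (Ψ.comp Φ) (fun h => (hΨ _).trans (hΦ h)) hκ hΨΦ
  have h2 := tnorm_sub_le hρ (Φ.comp Ψ) (fun h => (hΦ _).trans (hΨ h)) hκ hΦΨ
  have hiso : ∀ h, tnorm (Φ h) = tnorm h := fun h => le_antisymm (hΦ h)
    ((tnorm_le_of_tnorm_sub_le hσ _ hκ1 h1 h).trans (hΨ _))
  refine ⟨⟨?_, ?_⟩, hiso⟩
  · rw [injective_iff_map_eq_zero]
    intro h hh
    have := hiso h
    rw [hh] at this
    exact Subtype.ext ((gauss_eq_zero hσ h.2).1 (this.symm.trans gauss_zero))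
  · have := surjective_of_tnorm_sub_le hρ (Φ.comp Ψ) (fun h => (hΦ _).trans (hΨ h)) hκ hκ1 h2
    exact Function.Surjective.of_comp (g := Ψ) this

end Perturbation

section Morphisms

variable {k : Type*} [NormedField k] [IsUltrametricDist k] {n : ℕ} {r s : Fin n → ℝ}

theorem OpenPolydisc.ext {x y : OpenPolydisc k r} (h : ∀ f, x f = y f) : x = y := by
  obtain ⟨x, hx, hx'⟩ := x
  obtain ⟨y, hy, hy'⟩ := y
  obtain rfl : x = y := DFunLike.ext _ _ h
  rfl

theorem coe_restrict {ρ : Fin n → ℝ} (hρ : IsInnerRadius ρ r) (h : functions k r) :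
    (restrict hρ h : MvPowerSeries (Fin n) k) = h := rfl

/-- A morphism of algebras of functions extends to contracting morphisms between the Tate algebras
of large concentric closed polydiscs. -/
def ExtendsToTate (e : functions k s →ₐ[k] functions k r) : Prop :=
  ∀ᶠ c in 𝓝[<] (1 : ℝ), ∃ α : tateAlgebra k (fun i => c * s i) →ₐ[k] tateAlgebra k (fun i => c * r i),
    (∀ h, tnorm (α h) ≤ tnorm h) ∧
    ∀ (hs : IsInnerRadius (fun i => c * s i) s) (hr : IsInnerRadius (fun i => c * r i) r)
      (h : functions k s), α (restrict hs h) = restrict hr (e h)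

theorem ExtendsToTate.exists_chart (hr : ∀ i, 0 < r i) (hs : ∀ i, 0 < s i)
    {e : functions k s →ₐ[k] functions k r} (he : ExtendsToTate e) {ρ : Fin n → ℝ}
    (hρ : IsInnerRadius ρ r) : ∃ (σ : Fin n → ℝ) (hσ : IsInnerRadius σ s)
      (α : tateAlgebra k σ →ₐ[k] tateAlgebra k ρ),
      (∀ h, tnorm (α h) ≤ tnorm h) ∧ ∀ h, α (restrict hσ h) = restrict hρ (e h) := by
  obtain ⟨c, ⟨⟨h0, h1⟩, hc⟩, α, hα, hαe⟩ := (hρ.eventually_le.and he).exists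
  have hcr := isInnerRadius_smul hr h0 h1
  have hcs := isInnerRadius_smul hs h0 h1
  refine ⟨_, hcs, (Subalgebra.inclusion (tateAlgebra_mono hρ.pos hc)).comp α, fun h => ?_,
    fun h => ?_⟩
  · unfold tnorm
    rw [AlgHom.comp_apply, Subalgebra.coe_inclusion]
    exact (gauss_mono hρ.pos hc (α h).2).trans (hα h)
  · refine Subtype.ext ?_
    rw [AlgHom.comp_apply, hαe hcs hcr, Subalgebra.coe_inclusion, coe_restrict, coe_restrict]

theorem ExtendsToTate.exists_bound (hr : ∀ i, 0 < r i) (hs : ∀ i, 0 < s i)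
    {e : functions k s →ₐ[k] functions k r} (he : ExtendsToTate e) {ρ : Fin n → ℝ}
    (hρ : IsInnerRadius ρ r) : ∃ σ, IsInnerRadius σ s ∧ ∀ h : functions k s,
      gauss ρ (e h : MvPowerSeries (Fin n) k) ≤ gauss σ (h : MvPowerSeries (Fin n) k) := by
  obtain ⟨σ, hσ, α, hα, hαe⟩ := he.exists_chart hr hs hρ
  refine ⟨σ, hσ, fun h => ?_⟩
  have := hα (restrict hσ h)
  rw [hαe] at this
  exact this

/-- The map on points induced by a morphism of algebras of functions. -/
noncomputable def pointMap (hr : ∀ i, 0 < r i) (hs : ∀ i, 0 < s i)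
    (e : functions k s →ₐ[k] functions k r) (he : ExtendsToTate e) (x : OpenPolydisc k r) :
    OpenPolydisc k s where
  seminorm :=
    { toFun := fun h => x (e h)
      map_zero' := by simp
      add_le' := fun f g => by
        rw [map_add]
        exact map_add_le_add x.seminorm _ _
      neg' := fun f => by rw [map_neg, map_neg_eq_map]
      map_one' := by simp
      map_mul' := fun f g => by rw [map_mul, map_mul] }
  nonarchimedean f g := by
    change x (e (f + g)) ≤ max (x (e f)) (x (e g))
    rw [map_add]
    exact x.nonarchimedean _ _
  bounded := by
    obtain ⟨ρ, hρ, hx⟩ := x.bounded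
    obtain ⟨σ, hσ, h⟩ := he.exists_bound hr hs hρ
    exact ⟨σ, hσ, fun f => (hx _).trans (h f)⟩

/-- The morphism of open polydiscs induced by a morphism of algebras of functions. -/
noncomputable def PolydiscHom.ofPullback (hr : ∀ i, 0 < r i) (hs : ∀ i, 0 < s i)
    (e : functions k s →ₐ[k] functions k r) (he : ExtendsToTate e) : PolydiscHom k r s where
  toFun := pointMap hr hs e he
  continuous_toFun := continuous_induced_rng.2 (continuous_pi fun h => continuous_eval (e h))
  pullback := e
  abs_pullback _ _ := rfl
  chart ρ hρ := by
    obtain ⟨σ, hσ, α, hα, hαe⟩ := he.exists_chart hr hs hρ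
    refine ⟨σ, hσ, fun x hx h => (hx (e h)).trans ?_, α, ⟨1, fun h => ?_⟩, hαe⟩
    · have := hα (restrict hσ h)
      rw [hαe] at this
      exact this
    · rw [one_mul]
      exact hα h

theorem PolydiscHom.isIso_ofPullback (hr : ∀ i, 0 < r i) (hs : ∀ i, 0 < s i)
    (e : functions k s ≃ₐ[k] functions k r) (he : ExtendsToTate (e : functions k s →ₐ[k] functions k r))
    (he' : ExtendsToTate (e.symm : functions k r →ₐ[k] functions k s)) :
    (PolydiscHom.ofPullback hr hs _ he).IsIso := by
  refine ⟨PolydiscHom.ofPullback hs hr _ he', fun x => OpenPolydisc.ext fun h => ?_,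
    fun x => OpenPolydisc.ext fun h => ?_, ?_, ?_⟩
  · change x (e (e.symm h)) = x h
    rw [e.apply_symm_apply]
  · change x (e.symm (e h)) = x h
    rw [e.symm_apply_apply]
  · exact AlgHom.ext fun h => e.apply_symm_apply h
  · exact AlgHom.ext fun h => e.symm_apply_apply h

end Morphisms

section Bounded

variable {k : Type*} [NormedField k] [IsUltrametricDist k] {n : ℕ} {r : Fin n → ℝ}

/-- The coefficients of `h`, weighted by `r`, are bounded by `t`. -/
def CoeffBounded (r : Fin n → ℝ) (t : ℝ) (h : MvPowerSeries (Fin n) k) : Prop :=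
  ∀ I, ‖MvPowerSeries.coeff I h‖ * weight r I ≤ t

theorem norm_add_mul_weight_le (hr : ∀ i, 0 < r i) {a b : k} {t : ℝ} {I : Fin n →₀ ℕ}
    (ha : ‖a‖ * weight r I ≤ t) (hb : ‖b‖ * weight r I ≤ t) : ‖a + b‖ * weight r I ≤ t := by
  rw [← le_div_iff₀ (weight_pos hr I)] at *
  exact (IsUltrametricDist.norm_add_le_max a b).trans (max_le ha hb)

theorem CoeffBounded.add (hr : ∀ i, 0 < r i) {t : ℝ} {f g : MvPowerSeries (Fin n) k}
    (hf : CoeffBounded r t f) (hg : CoeffBounded r t g) : CoeffBounded r t (f + g) := fun I => by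
  rw [map_add]
  exact norm_add_mul_weight_le hr (hf I) (hg I)

theorem CoeffBounded.neg {t : ℝ} {f : MvPowerSeries (Fin n) k} (hf : CoeffBounded r t f) :
    CoeffBounded r t (-f) := fun I => by
  rw [map_neg, norm_neg]
  exact hf I

theorem CoeffBounded.sub (hr : ∀ i, 0 < r i) {t : ℝ} {f g : MvPowerSeries (Fin n) k}
    (hf : CoeffBounded r t f) (hg : CoeffBounded r t g) : CoeffBounded r t (f - g) :=
  sub_eq_add_neg f g ▸ hf.add hr hg.neg

theorem CoeffBounded.sum (hr : ∀ i, 0 < r i) {t : ℝ} (ht : 0 ≤ t) {ι : Type*} (S : Finset ι)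
    {f : ι → MvPowerSeries (Fin n) k} (hf : ∀ i, CoeffBounded r t (f i)) :
    CoeffBounded r t (∑ i ∈ S, f i) := by
  classical
  induction S using Finset.induction_on with
  | empty => intro I; simpa using ht
  | insert i S hi ih =>
    rw [Finset.sum_insert hi]
    exact (hf i).add hr ih

theorem CoeffBounded.C_mul {t u : ℝ} {c : k} {f : MvPowerSeries (Fin n) k}
    (hf : CoeffBounded r t f) (hc : ‖c‖ * t ≤ u) :
    CoeffBounded r u (MvPowerSeries.C c * f) := fun I => by
  rw [MvPowerSeries.coeff_C_mul, norm_mul, mul_assoc]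
  exact (mul_le_mul_of_nonneg_left (hf I) (norm_nonneg c)).trans hc

theorem coeffBounded_X (hr : ∀ i, 0 < r i) (l : Fin n) :
    CoeffBounded r (r l) (MvPowerSeries.X l : MvPowerSeries (Fin n) k) := fun I => by
  classical
  rw [MvPowerSeries.coeff_X]
  split_ifs with h
  · simp [h]
  · simpa using (hr l).le

theorem coeffBounded_C {t : ℝ} {c : k} (hc : ‖c‖ ≤ t) :
    CoeffBounded r t (MvPowerSeries.C c : MvPowerSeries (Fin n) k) := fun I => by
  classical
  rw [MvPowerSeries.coeff_C]
  split_ifs with h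
  · simpa [h] using hc
  · simpa using (norm_nonneg c).trans hc

theorem eq_zero_or_exists_single_add (I : Fin n →₀ ℕ) :
    I = 0 ∨ ∃ l J, I = Finsupp.single l 1 + J := by
  by_cases hI : I = 0
  · exact Or.inl hI
  · obtain ⟨l, hl⟩ := Finsupp.ne_iff.1 hI
    exact Or.inr ⟨l, I - Finsupp.single l 1, (add_tsub_cancel_of_le
      (Finsupp.single_le_iff.2 (Nat.one_le_iff_ne_zero.2 hl))).symm⟩

theorem degree_single_add (l : Fin n) (J : Fin n →₀ ℕ) :
    (Finsupp.single l 1 + J).degree = J.degree + 1 := by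
  rw [map_add, Finsupp.degree_single, add_comm]

/-- On the polydisc shrunk by a factor `c`, a power series with bounded coefficients and small
constant coefficient is small. -/
theorem gauss_smul_le {t c : ℝ} (ht : 0 ≤ t) (h0 : 0 < c) (h1 : c < 1)
    {h : MvPowerSeries (Fin n) k} (hh : CoeffBounded r t h)
    (hz : ‖MvPowerSeries.coeff 0 h‖ ≤ c * t) : gauss (fun i => c * r i) h ≤ c * t := by
  refine gauss_le fun I => ?_
  rw [weight_smul, mul_left_comm]
  rcases eq_zero_or_exists_single_add I with rfl | ⟨l, J, rfl⟩
  · simpa using hz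
  · rw [degree_single_add, pow_succ', mul_assoc]
    refine mul_le_mul_of_nonneg_left ((mul_le_mul_of_nonneg_left (hh _) (pow_nonneg h0.le _)).trans
      ?_) h0.le
    exact mul_le_of_le_one_left ht (pow_le_one₀ h0.le h1.le)

/-- The same with a quadratic factor if the linear coefficients are small as well. -/
theorem gauss_smul_le_sq {t c : ℝ} (ht : 0 ≤ t) (h0 : 0 < c) (h1 : c < 1)
    {h : MvPowerSeries (Fin n) k} (hh : CoeffBounded r t h)
    (hz : ‖MvPowerSeries.coeff 0 h‖ ≤ c * (c * t))
    (hl : ∀ l, ‖MvPowerSeries.coeff (Finsupp.single l 1) h‖ * r l ≤ c * t) :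
    gauss (fun i => c * r i) h ≤ c * (c * t) := by
  refine gauss_le fun I => ?_
  rw [weight_smul, mul_left_comm]
  rcases eq_zero_or_exists_single_add I with rfl | ⟨l, J, rfl⟩
  · simpa using hz
  · rw [degree_single_add, pow_succ', mul_assoc]
    refine mul_le_mul_of_nonneg_left ?_ h0.le
    rcases eq_zero_or_exists_single_add J with rfl | ⟨l', J, rfl⟩
    · simpa using hl l
    · rw [degree_single_add, pow_succ', mul_assoc]
      refine mul_le_mul_of_nonneg_left ((mul_le_mul_of_nonneg_left (hh _)
        (pow_nonneg h0.le _)).trans ?_) h0.le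
      exact mul_le_of_le_one_left ht (pow_le_one₀ h0.le h1.le)

theorem norm_sum_lt {t : ℝ} (ht : 0 < t) {ι : Type*} (S : Finset ι) {u : ι → k}
    (hu : ∀ i ∈ S, ‖u i‖ < t) : ‖∑ i ∈ S, u i‖ < t := by
  classical
  induction S using Finset.induction_on with
  | empty => simpa using ht
  | insert i S hi ih =>
    rw [Finset.sum_insert hi]
    exact (IsUltrametricDist.norm_add_le_max _ _).trans_lt
      (max_lt (hu i (by simp)) (ih fun j hj => hu j (by simp [hj])))

theorem eventually_le_mul {a b : ℝ} (h : a < b) : ∀ᶠ c in 𝓝[<] (1 : ℝ), a ≤ c * b :=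
  (eventually_lt_mul h).mono fun _ hc => hc.le

theorem eventually_le_mul_mul {a b : ℝ} (h : a < b) :
    ∀ᶠ c in 𝓝[<] (1 : ℝ), a ≤ c * (c * b) := by
  have : Tendsto (fun c : ℝ => c * (c * b)) (𝓝 1) (𝓝 b) := by
    simpa using (by fun_prop : Continuous fun c : ℝ => c * (c * b)).tendsto 1
  exact ((this.eventually (eventually_gt_nhds h)).filter_mono nhdsWithin_le_nhds).mono
    fun _ hc => hc.le

end Bounded

section CoordinateSystem

variable {k : Type*} [NormedField k] [IsUltrametricDist k] [CompleteSpace k] {n : ℕ}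
  {r s : Fin n → ℝ}

/-- The linear form with the coefficients of the `j`-th row of a matrix. -/
noncomputable def linearForm (d : Matrix (Fin n) (Fin n) k) (j : Fin n) : MvPolynomial (Fin n) k :=
  ∑ i, MvPolynomial.C (d j i) * MvPolynomial.X i

theorem coe_linearForm (d : Matrix (Fin n) (Fin n) k) (j : Fin n) :
    (linearForm d j : MvPowerSeries (Fin n) k) =
      ∑ i, MvPowerSeries.C (d j i) * MvPowerSeries.X i := by
  simp only [linearForm, ← MvPolynomial.coeToMvPowerSeries.ringHom_apply, map_sum, map_mul]
  simp [MvPolynomial.coeToMvPowerSeries.ringHom_apply]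

theorem aeval_linearForm (d : Matrix (Fin n) (Fin n) k) (j : Fin n)
    (g : Fin n → MvPowerSeries (Fin n) k) :
    MvPolynomial.aeval g (linearForm d j) = ∑ i, MvPowerSeries.C (d j i) * g i := by
  simp only [linearForm, map_sum, map_mul, MvPolynomial.aeval_C, MvPolynomial.aeval_X]
  rfl

theorem gauss_linearForm_le (hr : ∀ i, 0 < r i) {d : Matrix (Fin n) (Fin n) k} {j : Fin n} {t : ℝ}
    (ht : 0 ≤ t) (hd : ∀ i, ‖d j i‖ * r i ≤ t) :
    gauss r (linearForm d j : MvPowerSeries (Fin n) k) ≤ t := by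
  rw [coe_linearForm]
  refine gauss_sum_le hr _ (fun i _ => mul_mem (C_mem_tateAlgebra _) (X_mem_tateAlgebra _)) ht ?_
  intro i _
  rw [gauss_mul hr (C_mem_tateAlgebra _) (X_mem_tateAlgebra _), gauss_C hr, gauss_X hr]
  exact hd i

theorem aeval_linearForm_linearForm (a d : Matrix (Fin n) (Fin n) k) (i : Fin n) :
    MvPolynomial.aeval (fun j => (linearForm d j : MvPowerSeries (Fin n) k)) (linearForm a i) =
      (linearForm (a * d) i : MvPowerSeries (Fin n) k) := by
  rw [aeval_linearForm, coe_linearForm]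
  simp only [coe_linearForm, Finset.mul_sum, Matrix.mul_apply, map_sum, Finset.sum_mul, map_mul,
    mul_assoc]
  exact Finset.sum_comm

theorem linearForm_sub_one (d : Matrix (Fin n) (Fin n) k) (i : Fin n) :
    (linearForm (d - 1) i : MvPowerSeries (Fin n) k) =
      (linearForm d i : MvPowerSeries (Fin n) k) - MvPowerSeries.X i := by
  classical
  rw [coe_linearForm, coe_linearForm]
  simp only [Matrix.sub_apply, map_sub, sub_mul, Finset.sum_sub_distrib, Matrix.one_apply]
  simp

theorem coeff_linearForm (d : Matrix (Fin n) (Fin n) k) (i l : Fin n) :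
    MvPowerSeries.coeff (Finsupp.single l 1) (linearForm d i : MvPowerSeries (Fin n) k) = d i l := by
  classical
  rw [coe_linearForm, map_sum]
  simp [MvPowerSeries.coeff_C_mul, MvPowerSeries.coeff_X, Finsupp.single_left_inj]

theorem coeff_zero_linearForm (d : Matrix (Fin n) (Fin n) k) (i : Fin n) :
    MvPowerSeries.coeff 0 (linearForm d i : MvPowerSeries (Fin n) k) = 0 := by
  classical
  rw [coe_linearForm, map_sum]
  simp

/-- The matrix of the linear coefficients of a family of functions. -/
noncomputable def jacobian (f : Fin n → functions k r) : Matrix (Fin n) (Fin n) k :=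
  Matrix.of fun i l => slope l (f i)

/-- The family `f` of functions on the open polydisc of polyradius `r`, the `i`-th of them being
of size at most `s i`, is inverted modulo smaller terms by the matrix `d`. -/
structure IsAlmostInverse (s : Fin n → ℝ) (f : Fin n → functions k r)
    (d : Matrix (Fin n) (Fin n) k) : Prop where
  bounded : ∀ i, CoeffBounded r (s i) (f i : MvPowerSeries (Fin n) k)
  zero : ∀ i, ‖MvPowerSeries.coeff 0 (f i : MvPowerSeries (Fin n) k)‖ < s i
  matrix_le : ∀ j i, ‖d j i‖ * s i ≤ r j
  left : ∀ j l, ‖(d * jacobian f - 1) j l‖ * r l < r j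
  right : ∀ i l, ‖(jacobian f * d - 1) i l‖ * s l < s i

variable {f : Fin n → functions k r} {d : Matrix (Fin n) (Fin n) k}

theorem IsAlmostInverse.norm_constant_lt (H : IsAlmostInverse s f d) (hr : ∀ i, 0 < r i)
    (j : Fin n) : ‖∑ i, d j i * MvPowerSeries.coeff 0 (f i : MvPowerSeries (Fin n) k)‖ < r j := by
  refine norm_sum_lt (hr j) _ fun i _ => ?_
  rw [norm_mul]
  rcases (norm_nonneg (d j i)).eq_or_lt with h | h
  · rw [← h, zero_mul]
    exact hr j
  · exact (mul_lt_mul_of_pos_left (H.zero i) h).trans_le (H.matrix_le j i)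

/-- The composition of substitutions, on the coordinates of the source. -/
theorem IsAlmostInverse.gauss_left_le (H : IsAlmostInverse s f d) (hr : ∀ i, 0 < r i)
    {c : ℝ} (h0 : 0 < c) (h1 : c < 1) (j : Fin n)
    (hc0 : ‖∑ i, d j i * MvPowerSeries.coeff 0 (f i : MvPowerSeries (Fin n) k)‖ ≤ c * (c * r j))
    (hc : ∀ l, ‖(d * jacobian f - 1) j l‖ * r l ≤ c * r j) :
    gauss (fun i => c * r i)
      (substitute (fun i => (f i : MvPowerSeries (Fin n) k))
        (linearForm d j : MvPowerSeries (Fin n) k) - MvPowerSeries.X j) ≤ c * (c * r j) := by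
  classical
  rw [substitute_coe, aeval_linearForm]
  refine gauss_smul_le_sq (hr j).le h0 h1 ?_ ?_ ?_
  · exact (CoeffBounded.sum hr (hr j).le _ fun i => (H.bounded i).C_mul (H.matrix_le j i)).sub hr
      (coeffBounded_X hr j)
  · rw [map_sub, map_sum]
    simpa [MvPowerSeries.coeff_C_mul] using hc0
  · intro l
    have e : MvPowerSeries.coeff (Finsupp.single l 1)
        (∑ i, MvPowerSeries.C (d j i) * (f i : MvPowerSeries (Fin n) k) - MvPowerSeries.X j) =
        (d * jacobian f - 1) j l := by
      rw [map_sub, map_sum, Matrix.sub_apply, Matrix.mul_apply, Matrix.one_apply,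
        MvPowerSeries.coeff_X]
      simp only [MvPowerSeries.coeff_C_mul, jacobian, Matrix.of_apply, slope_apply,
        Finsupp.single_left_inj one_ne_zero, eq_comm]
    rw [e]
    exact hc l

theorem IsAlmostInverse.gauss_right_le (H : IsAlmostInverse s f d) (hr : ∀ i, 0 < r i)
    (hs : ∀ i, 0 < s i) {c : ℝ} (h0 : 0 < c) (h1 : c < 1) (i : Fin n)
    (hd : ∀ j, gauss (fun i => c * s i) (linearForm d j : MvPowerSeries (Fin n) k) ≤ c * r j)
    (hc0 : ‖MvPowerSeries.coeff 0 (f i : MvPowerSeries (Fin n) k)‖ ≤ c * (c * s i))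
    (hc : ∀ l, ‖(jacobian f * d - 1) i l‖ * s l ≤ c * s i) :
    gauss (fun i => c * s i)
      (substitute (fun j => (linearForm d j : MvPowerSeries (Fin n) k))
        (f i : MvPowerSeries (Fin n) k) - MvPowerSeries.X i) ≤ c * (c * s i) := by
  classical
  have hcr : ∀ j, 0 < c * r j := fun j => mul_pos h0 (hr j)
  have hcs : ∀ j, 0 < c * s j := fun j => mul_pos h0 (hs j)
  set a₀ := MvPowerSeries.coeff 0 (f i : MvPowerSeries (Fin n) k) with ha₀
  set P : MvPolynomial (Fin n) k := MvPolynomial.C a₀ + linearForm (jacobian f) i with hP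
  have hPc : (P : MvPowerSeries (Fin n) k) =
      MvPowerSeries.C a₀ + (linearForm (jacobian f) i : MvPowerSeries (Fin n) k) := by
    rw [hP, MvPolynomial.coe_add, MvPolynomial.coe_C]
  set q : MvPowerSeries (Fin n) k := f i - (P : MvPowerSeries (Fin n) k) with hq
  have hq_mem : q ∈ tateAlgebra k fun i => c * r i :=
    sub_mem ((f i).2 _ (isInnerRadius_smul hr h0 h1)) (coe_mem_tateAlgebra P)
  have hlin : CoeffBounded r (s i) (P : MvPowerSeries (Fin n) k) := by
    rw [hPc, coe_linearForm]
    refine (coeffBounded_C (hc0.trans ?_)).add hr (CoeffBounded.sum hr (hs i).le _ fun l =>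
      (coeffBounded_X hr l).C_mul ?_)
    · rw [← mul_assoc]
      exact mul_le_of_le_one_left (hs i).le (mul_le_one₀ h1.le h0.le h1.le)
    · simpa using! H.bounded i (Finsupp.single l 1)
  have hqg : gauss (fun i => c * r i) q ≤ c * (c * s i) := by
    refine gauss_smul_le_sq (hs i).le h0 h1 ((H.bounded i).sub hr hlin) ?_ fun l => ?_
    · have : MvPowerSeries.coeff 0 q = 0 := by
        rw [hq, hPc, map_sub, map_add, coeff_zero_linearForm, MvPowerSeries.coeff_zero_C, add_zero,
          sub_self]
      rw [this, norm_zero]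
      exact mul_nonneg h0.le (hcs i).le
    · have : MvPowerSeries.coeff (Finsupp.single l 1) q = 0 := by
        rw [hq, hPc, map_sub, map_add, coeff_linearForm, MvPowerSeries.coeff_C,
          if_neg (Finsupp.single_ne_zero.2 one_ne_zero), zero_add]
        exact sub_self _
      rw [this, norm_zero, zero_mul]
      exact (hcs i).le
  have hg : ∀ j, (linearForm d j : MvPowerSeries (Fin n) k) ∈ tateAlgebra k fun i => c * s i :=
    fun j => coe_mem_tateAlgebra _
  have e : substitute (fun j => (linearForm d j : MvPowerSeries (Fin n) k))
        (f i : MvPowerSeries (Fin n) k) - MvPowerSeries.X i =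
      substitute (fun j => (linearForm d j : MvPowerSeries (Fin n) k)) q +
        (MvPowerSeries.C a₀ + (linearForm (jacobian f * d - 1) i : MvPowerSeries (Fin n) k)) := by
    have h2 : (f i : MvPowerSeries (Fin n) k) = q + (P : MvPowerSeries (Fin n) k) :=
      (sub_add_cancel _ _).symm
    have h3 : (MvPolynomial.aeval fun j => (linearForm d j : MvPowerSeries (Fin n) k))
        (MvPolynomial.C a₀) = MvPowerSeries.C a₀ := MvPolynomial.aeval_C _ _
    rw [h2, substitute_add hcs hg hd hq_mem (coe_mem_tateAlgebra P), substitute_coe, hP, map_add,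
      aeval_linearForm_linearForm, linearForm_sub_one, h3]
    ring
  rw [e]
  refine (gauss_add_le hcs (substitute_mem hcs hg hd hq_mem) (add_mem (C_mem_tateAlgebra _)
    (coe_mem_tateAlgebra _))).trans (max_le ((gauss_substitute_le hcs hg hd hq_mem).trans hqg) ?_)
  refine (gauss_add_le hcs (C_mem_tateAlgebra _) (coe_mem_tateAlgebra _)).trans (max_le ?_ ?_)
  · rw [gauss_C hcs]
    exact hc0
  · refine gauss_linearForm_le hcs (mul_nonneg h0.le (hcs i).le) fun l => ?_
    rw [mul_left_comm]
    exact mul_le_mul_of_nonneg_left (hc l) h0.le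

/-- Substitution of `f` is an isometric isomorphism between the Tate algebras of large
concentric closed polydiscs. -/
theorem IsAlmostInverse.eventually_bijective (H : IsAlmostInverse s f d) (hr : ∀ i, 0 < r i)
    (hs : ∀ i, 0 < s i) : ∀ᶠ c in 𝓝[<] (1 : ℝ), (0 < c ∧ c < 1) ∧
      ∃ Φ : tateAlgebra k (fun i => c * s i) →ₐ[k] tateAlgebra k (fun i => c * r i),
        (∀ h, (Φ h : MvPowerSeries (Fin n) k) =
          substitute (fun i => (f i : MvPowerSeries (Fin n) k)) h) ∧
        Function.Bijective Φ ∧ ∀ h, tnorm (Φ h) = tnorm h := by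
  have e1 : ∀ᶠ c in 𝓝[<] (1 : ℝ), ∀ i,
      ‖MvPowerSeries.coeff 0 (f i : MvPowerSeries (Fin n) k)‖ ≤ c * (c * s i) :=
    eventually_all.2 fun i => eventually_le_mul_mul (H.zero i)
  have e2 : ∀ᶠ c in 𝓝[<] (1 : ℝ), ∀ j,
      ‖∑ i, d j i * MvPowerSeries.coeff 0 (f i : MvPowerSeries (Fin n) k)‖ ≤ c * (c * r j) :=
    eventually_all.2 fun j => eventually_le_mul_mul (H.norm_constant_lt hr j)
  have e3 : ∀ᶠ c in 𝓝[<] (1 : ℝ), ∀ j l, ‖(d * jacobian f - 1) j l‖ * r l ≤ c * r j :=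
    eventually_all.2 fun j => eventually_all.2 fun l => eventually_le_mul (H.left j l)
  have e4 : ∀ᶠ c in 𝓝[<] (1 : ℝ), ∀ i l, ‖(jacobian f * d - 1) i l‖ * s l ≤ c * s i :=
    eventually_all.2 fun i => eventually_all.2 fun l => eventually_le_mul (H.right i l)
  filter_upwards [eventually_pos_lt_one, e1, e2, e3, e4] with c hc hc1 hc2 hc3 hc4
  obtain ⟨h0, h1⟩ := hc
  refine ⟨⟨h0, h1⟩, ?_⟩
  have hcr : ∀ j, 0 < c * r j := fun j => mul_pos h0 (hr j)
  have hcs : ∀ j, 0 < c * s j := fun j => mul_pos h0 (hs j)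
  have hg : ∀ i, (f i : MvPowerSeries (Fin n) k) ∈ tateAlgebra k fun i => c * r i :=
    fun i => (f i).2 _ (isInnerRadius_smul hr h0 h1)
  have hgs : ∀ i, gauss (fun i => c * r i) (f i : MvPowerSeries (Fin n) k) ≤ c * s i := fun i =>
    gauss_smul_le (hs i).le h0 h1 (H.bounded i)
      ((hc1 i).trans (mul_le_of_le_one_left (hcs i).le h1.le))
  have hd : ∀ j, (linearForm d j : MvPowerSeries (Fin n) k) ∈ tateAlgebra k fun i => c * s i :=
    fun j => coe_mem_tateAlgebra _
  have hdr : ∀ j, gauss (fun i => c * s i) (linearForm d j : MvPowerSeries (Fin n) k) ≤ c * r j :=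
    fun j => gauss_linearForm_le hcs (hcr j).le fun i => by
      rw [mul_left_comm]
      exact mul_le_mul_of_nonneg_left (H.matrix_le j i) h0.le
  let Φ := substHom hcr hcs hg hgs
  let Ψ := substHom hcs hcr hd hdr
  refine ⟨Φ, fun _ => rfl, bijective_of_almost_inverse hcr hcs Φ Ψ
    (fun h => gauss_substitute_le hcr hg hgs h.2) (fun h => gauss_substitute_le hcs hd hdr h.2)
    h0.le h1 (fun i => ?_) (fun j => ?_)⟩
  · have := H.gauss_right_le hr hs h0 h1 i hdr (hc1 i) (hc4 i)
    rw [← substitute_X (g := fun i => (f i : MvPowerSeries (Fin n) k)) i] at this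
    exact this
  · have := H.gauss_left_le hr h0 h1 j (hc2 j) (hc3 j)
    rw [← substitute_X (g := fun j => (linearForm d j : MvPowerSeries (Fin n) k)) j] at this
    exact this

theorem IsAlmostInverse.substitute_mem_functions (H : IsAlmostInverse s f d) (hr : ∀ i, 0 < r i)
    (hs : ∀ i, 0 < s i) (h : functions k s) :
    substitute (fun i => (f i : MvPowerSeries (Fin n) k)) (h : MvPowerSeries (Fin n) k) ∈
      functions k r := by
  intro ρ hρ
  obtain ⟨c, ⟨⟨h0, h1⟩, Φ, hΦ, -⟩, -, hc⟩ :=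
    ((H.eventually_bijective hr hs).and hρ.eventually_le).exists
  have := (Φ (restrict (isInnerRadius_smul hs h0 h1) h)).2
  rw [hΦ, coe_restrict] at this
  exact tateAlgebra_mono hρ.pos hc this

/-- Substitution of `f` as a morphism of algebras of functions. -/
theorem IsAlmostInverse.exists_algHom (H : IsAlmostInverse s f d) (hr : ∀ i, 0 < r i)
    (hs : ∀ i, 0 < s i) : ∃ e : functions k s →ₐ[k] functions k r,
      (∀ h, (e h : MvPowerSeries (Fin n) k) =
        substitute (fun i => (f i : MvPowerSeries (Fin n) k)) h) ∧ Function.Bijective e := by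
  obtain ⟨c, ⟨h0, h1⟩, Φ, hΦ, hΦb, -⟩ := (H.eventually_bijective hr hs).exists
  have hcs := isInnerRadius_smul hs h0 h1
  have hcr := isInnerRadius_smul hr h0 h1
  have hΦr : ∀ h : functions k s, (Φ (restrict hcs h) : MvPowerSeries (Fin n) k) =
      substitute (fun i => (f i : MvPowerSeries (Fin n) k)) h := fun h => hΦ _
  let e : functions k s →ₐ[k] functions k r :=
    { toFun := fun h => ⟨_, H.substitute_mem_functions hr hs h⟩
      map_zero' := Subtype.ext <| by
        change substitute _ ((0 : functions k s) : MvPowerSeries (Fin n) k) = 0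
        rw [← hΦr, map_zero, map_zero, ZeroMemClass.coe_zero]
      map_one' := Subtype.ext <| by
        change substitute _ ((1 : functions k s) : MvPowerSeries (Fin n) k) = 1
        rw [← hΦr, map_one, map_one, OneMemClass.coe_one]
      map_add' := fun h h' => Subtype.ext <| by
        change substitute _ ((h + h' : functions k s) : MvPowerSeries (Fin n) k) =
          substitute _ (h : MvPowerSeries (Fin n) k) + substitute _ (h' : MvPowerSeries (Fin n) k)
        rw [← hΦr, ← hΦr, ← hΦr, map_add, map_add, AddMemClass.coe_add]
      map_mul' := fun h h' => Subtype.ext <| by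
        change substitute _ ((h * h' : functions k s) : MvPowerSeries (Fin n) k) =
          substitute _ (h : MvPowerSeries (Fin n) k) * substitute _ (h' : MvPowerSeries (Fin n) k)
        rw [← hΦr, ← hΦr, ← hΦr, map_mul, map_mul, MulMemClass.coe_mul]
      commutes' := fun a => Subtype.ext (substitute_C a) }
  have he : ∀ h, (e h : MvPowerSeries (Fin n) k) =
      substitute (fun i => (f i : MvPowerSeries (Fin n) k)) h := fun _ => rfl
  refine ⟨e, he, fun h h' hh => ?_, fun y => ?_⟩
  · have : Φ (restrict hcs h) = Φ (restrict hcs h') :=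
      Subtype.ext (by rw [hΦr, hΦr, ← he, ← he, hh])
    have := congrArg Subtype.val (hΦb.1 this)
    rw [coe_restrict, coe_restrict] at this
    exact Subtype.ext this
  · obtain ⟨h, hh⟩ := hΦb.2 (restrict hcr y)
    have hval : substitute (fun i => (f i : MvPowerSeries (Fin n) k))
        (h : MvPowerSeries (Fin n) k) = y := by rw [← hΦ, hh, coe_restrict]
    have hmem : (h : MvPowerSeries (Fin n) k) ∈ functions k s := by
      intro σ hσ
      have hev : ∀ᶠ c' in 𝓝[<] (1 : ℝ), c ≤ c' :=
        (eventually_gt_nhds h1).filter_mono nhdsWithin_le_nhds |>.mono fun _ h => h.le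
      obtain ⟨c', ⟨⟨⟨h0', h1'⟩, Φ', hΦ', hΦb', -⟩, -, hσc⟩, hcc⟩ :=
        (((H.eventually_bijective hr hs).and hσ.eventually_le).and hev).exists
      obtain ⟨h', hh'⟩ := hΦb'.2 (restrict (isInnerRadius_smul hr h0' h1') y)
      have hval' : substitute (fun i => (f i : MvPowerSeries (Fin n) k))
          (h' : MvPowerSeries (Fin n) k) = y := by rw [← hΦ', hh', coe_restrict]
      have hmem' : (h' : MvPowerSeries (Fin n) k) ∈ tateAlgebra k fun i => c * s i :=
        tateAlgebra_mono hcs.pos (fun i => mul_le_mul_of_nonneg_right hcc (hs i).le) h'.2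
      have heq : h = ⟨h', hmem'⟩ := hΦb.1 (Subtype.ext (by rw [hΦ, hΦ, hval, hval']))
      rw [heq]
      exact tateAlgebra_mono hσ.pos hσc h'.2
    exact ⟨⟨h, hmem⟩, Subtype.ext (by rw [he]; exact hval)⟩

theorem IsAlmostInverse.isCoordinateSystem (H : IsAlmostInverse s f d) (hr : ∀ i, 0 < r i)
    (hs : ∀ i, 0 < s i) : IsCoordinateSystem f := by
  obtain ⟨e₀, he₀, hb⟩ := H.exists_algHom hr hs
  let e := AlgEquiv.ofBijective e₀ hb
  have he : ∀ h, (e h : MvPowerSeries (Fin n) k) =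
      substitute (fun i => (f i : MvPowerSeries (Fin n) k)) h := he₀
  have h1 : ExtendsToTate (e : functions k s →ₐ[k] functions k r) := by
    filter_upwards [H.eventually_bijective hr hs] with c hc
    obtain ⟨-, Φ, hΦ, -, hiso⟩ := hc
    refine ⟨Φ, fun h => (hiso h).le, fun hcs hcr h => Subtype.ext ?_⟩
    rw [hΦ, coe_restrict, coe_restrict]
    exact (he h).symm
  have h2 : ExtendsToTate (e.symm : functions k r →ₐ[k] functions k s) := by
    filter_upwards [H.eventually_bijective hr hs] with c hc
    obtain ⟨-, Φ, hΦ, hΦb, hiso⟩ := hc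
    let E := AlgEquiv.ofBijective Φ hΦb
    have hE : ∀ h, Φ (E.symm h) = h := fun h => E.apply_symm_apply h
    refine ⟨E.symm, fun h => ?_, fun hcr hcs h => hΦb.1 ?_⟩
    · have := hiso (E.symm h)
      rw [hE] at this
      exact this.ge
    · refine (hE _).trans (Subtype.ext ?_)
      rw [hΦ, coe_restrict, coe_restrict]
      refine Eq.trans ?_ (he (e.symm h))
      rw [e.apply_symm_apply]
  refine ⟨s, hs, PolydiscHom.ofPullback hr hs _ h1, PolydiscHom.isIso_ofPullback hr hs e h1 h2,
    fun i => Subtype.ext ?_⟩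
  exact (he _).trans (substitute_X i)

end CoordinateSystem

section Pullback

variable {k : Type*} [NormedField k] [IsUltrametricDist k] {n : ℕ} {r s : Fin n → ℝ}

theorem PolydiscHom.supNorm_pullback_le (φ : PolydiscHom k r s) (h : functions k s) :
    supNorm (φ.pullback h) ≤ supNorm h := by
  refine iSup_le fun x => ?_
  rw [φ.abs_pullback]
  exact le_iSup (fun y : OpenPolydisc k s => ENNReal.ofReal (y h)) (φ.toFun x)

theorem PolydiscHom.pullback_mem_le (φ : PolydiscHom k r s) (t : Degree) (h : functions k s)
    (hh : h ∈ (functionFiltration k s).le t) : φ.pullback h ∈ (functionFiltration k r).le t :=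
  (φ.supNorm_pullback_le h).trans hh

theorem PolydiscHom.pullback_mem_lt (φ : PolydiscHom k r s) (t : Degree) (h : functions k s)
    (hh : h ∈ (functionFiltration k s).lt t) : φ.pullback h ∈ (functionFiltration k r).lt t := by
  intro K hK ε hε
  obtain ⟨g, hg, hgK⟩ := hh _ (hK.image φ.continuous_toFun) ε hε
  refine ⟨φ.pullback g, (φ.supNorm_pullback_le g).trans_lt hg, fun x hx => ?_⟩
  rw [← map_sub, φ.abs_pullback]
  exact hgK _ ⟨x, hx, rfl⟩

/-- The morphism of graded reductions induced by a morphism of open polydiscs. -/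
noncomputable def PolydiscHom.reductionMap (φ : PolydiscHom k r s) :
    FunctionReduction k s →+* FunctionReduction k r :=
  GradedReduction.map (φ.pullback : functions k s →+* functions k r) φ.pullback_mem_le
    φ.pullback_mem_lt

theorem PolydiscHom.reductionMap_hom (φ : PolydiscHom k r s) {t : Degree} {h : functions k s}
    (hh : h ∈ (functionFiltration k s).le t) :
    φ.reductionMap (hom _ t h) = hom (functionFiltration k r) t (φ.pullback h) :=
  map_hom _ _ _ hh

theorem PolydiscHom.mem_originIdeal_of_reductionMap (φ : PolydiscHom k r s) (hr : ∀ i, 0 < r i)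
    (hs : ∀ i, 0 < s i) {x : FunctionReduction k s} (hx : φ.reductionMap x ∈ originIdeal k hr) :
    x ∈ originIdeal k hs :=
  le_originIdeal hs
    (isHomogeneousIdeal_comap φ.pullback_mem_le φ.pullback_mem_lt (originIdeal_isHomogeneous hr))
    (Ideal.comap_ne_top φ.reductionMap (RingHom.ker_ne_top (augmentation hr))) hx

theorem reductionMap_reductionMap {φ : PolydiscHom k r s} {ψ : PolydiscHom k s r}
    (h : φ.pullback.comp ψ.pullback = AlgHom.id k (functions k r)) (x : FunctionReduction k r) :
    φ.reductionMap (ψ.reductionMap x) = x := by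
  induction x using reduction_induction with
  | h0 => simp
  | hadd x y hx hy => rw [map_add, map_add, hx, hy]
  | h t a ha =>
    rw [ψ.reductionMap_hom ha, φ.reductionMap_hom (ψ.pullback_mem_le t a ha), ← AlgHom.comp_apply,
      h, AlgHom.id_apply]

/-- The reductions of the functions of a coordinate system generate the maximal homogeneous
ideal. -/
theorem IsCoordinateSystem.span_reduction (hr : ∀ i, 0 < r i) {f : Fin n → functions k r}
    (hf : IsCoordinateSystem f) : (∀ i, reduction (f i) ∈ originIdeal k hr) ∧
      Ideal.span (Set.range fun i => reduction (f i)) = originIdeal k hr := by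
  obtain ⟨s, hs, φ, ⟨ψ, -, -, hφψ, hψφ⟩, hφ⟩ := hf
  have hred : ∀ i, reduction (f i) = φ.reductionMap
      (hom (functionFiltration k s) (Degree.mk (s i) (hs i)) (coordinate s i)) := by
    intro i
    rw [φ.reductionMap_hom (coordinate_mem_le hs i), hφ]
    refine reduction_eq_hom (le_antisymm ?_ ?_)
    · rw [← hφ]
      exact (φ.supNorm_pullback_le _).trans (supNorm_coordinate hs i).le
    · have h1 : ψ.pullback (f i) = coordinate s i := by
        rw [← hφ, ← AlgHom.comp_apply, hψφ, AlgHom.id_apply]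
      exact (supNorm_coordinate hs i).ge.trans (h1 ▸ ψ.supNorm_pullback_le (f i))
  have hmem : ∀ x ∈ originIdeal k hs, φ.reductionMap x ∈ originIdeal k hr := fun x hx =>
    ψ.mem_originIdeal_of_reductionMap hs hr (by rwa [reductionMap_reductionMap hψφ])
  have hf : ∀ i, reduction (f i) ∈ originIdeal k hr := fun i => by
    rw [hred]
    exact hmem _ (hom_coordinate_mem hs i)
  refine ⟨hf, le_antisymm (Ideal.span_le.2 ?_) fun x hx => ?_⟩
  · rintro _ ⟨i, rfl⟩
    exact hf i
  · have h1 : ψ.reductionMap x ∈ originIdeal k hs :=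
      φ.mem_originIdeal_of_reductionMap hr hs (by rwa [reductionMap_reductionMap hφψ])
    rw [← span_coordinates hs] at h1
    have h2 := Ideal.mem_map_of_mem φ.reductionMap h1
    rw [reductionMap_reductionMap hφψ, Ideal.map_span, ← Set.range_comp] at h2
    convert h2 using 4 with i
    exact hred i

end Pullback

section Cotangent

variable {k : Type*} [NormedField k] [IsUltrametricDist k] {n : ℕ} {r s : Fin n → ℝ}

/-- If a sum of products with homogeneous elements of `k` is homogeneous, it can be computed by
lifting the relevant homogeneous components. -/
theorem norm_sum_sub_lt {ι : Type*} [Fintype ι] {t : Degree} {α β : ι → Degree}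
    (hαβ : ∀ i, α i + β i = t) {a b : ι → k} (ha : ∀ i, a i ∈ (fieldFiltration k).le (α i))
    (hb : ∀ i, b i ∈ (fieldFiltration k).le (β i)) {x : ι → GradedResidueField k}
    (hx : ∀ i, x i (β i) = Piece.mk _ (β i) (b i) (hb i)) {e : k}
    (he : e ∈ (fieldFiltration k).le t)
    (h : ∑ i, hom (fieldFiltration k) (α i) (a i) * x i = hom _ t e) :
    ‖∑ i, a i * b i - e‖ < t.val := by
  have hab : ∀ i, a i * b i ∈ (fieldFiltration k).le t := fun i =>
    hαβ i ▸ (fieldFiltration k).mul_mem (ha i) (hb i)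
  have hterm : ∀ i, (hom (fieldFiltration k) (α i) (a i) * x i) t =
      hom (fieldFiltration k) t (a i * b i) t := by
    intro i
    have h1 := hom_mul_apply (ha i) (hb i) (x i) (hx i)
    rw [← hom_apply_self, hαβ i] at h1
    exact h1
  have hsum := congrArg (fun y => y t) h
  dsimp only at hsum
  rw [DFinsupp.finsetSum_apply, Finset.sum_congr rfl fun i _ => hterm i,
    ← DFinsupp.finsetSum_apply, ← hom_sum _ fun i _ => hab i,
    hom_apply_self (sum_mem fun i _ => hab i), hom_apply_self he, Piece.mk_eq_mk, mem_field_lt,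
    neg_add_eq_sub, norm_sub_rev] at hsum
  exact hsum

theorem hom_one_matrix {p : Fin n → Degree} (j l : Fin n) :
    (1 : Matrix (Fin n) (Fin n) k) j l ∈ (fieldFiltration k).le (p j - p l) ∧
    (1 : Matrix (Fin n) (Fin n) (GradedResidueField k)) j l =
      hom (fieldFiltration k) (p j - p l) ((1 : Matrix (Fin n) (Fin n) k) j l) := by
  by_cases h : j = l
  · subst h
    rw [Matrix.one_apply_eq, Matrix.one_apply_eq, sub_self, hom_one]
    exact ⟨Filtration.one_mem _, rfl⟩
  · rw [Matrix.one_apply_ne h, Matrix.one_apply_ne h, hom_zero]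
    exact ⟨zero_mem _, rfl⟩

theorem exists_isAlmostInverse (hr : ∀ i, 0 < r i) {f : Fin n → functions k r}
    (hf : ∀ i, supNorm (f i) < ⊤) (hm : ∀ i, reduction (f i) ∈ originIdeal k hr)
    (hind : LinearIndependent (GradedResidueField k)
      fun i => (originIdeal k hr).toCotangent ⟨reduction (f i), hm i⟩)
    (hspan : Submodule.span (GradedResidueField k)
      (Set.range fun i => (originIdeal k hr).toCotangent ⟨reduction (f i), hm i⟩) = ⊤) :
    ∃ s : Fin n → ℝ, (∀ i, 0 < s i) ∧ ∃ d, IsAlmostInverse s f d := by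
  have hs : ∀ i, 0 < (supNorm (f i)).toReal := by
    intro i
    by_contra h
    have h0 : reduction (f i) = 0 := dif_neg h
    have h1 : (⟨reduction (f i), hm i⟩ : originIdeal k hr) = 0 := Subtype.ext h0
    exact hind.ne_zero i (by rw [h1, map_zero])
  have hsup : ∀ i, supNorm (f i) = ENNReal.ofReal (supNorm (f i)).toReal := fun i =>
    (ENNReal.ofReal_toReal (hf i).ne).symm
  let S : Fin n → Degree := fun i => Degree.mk _ (hs i)
  let R : Fin n → Degree := fun i => Degree.mk _ (hr i)
  have hred : ∀ i, reduction (f i) = hom (functionFiltration k r) (S i) (f i) := fun i =>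
    reduction_eq_hom (hsup i)
  have hle : ∀ i, f i ∈ (functionFiltration k r).le (S i) := fun i => (hsup i).le
  obtain ⟨c, hcl, hcr⟩ := exists_inverse_matrix (I := originIdeal k hr) (fun x => mem_originIdeal)
    (augmentation_algebraMap hr) (linearCoeff_mul hr) (linearCoeff_algebraMap hr)
    (hom_coordinate_mem hr) (linearCoeff_coordinate hr) (fun i => reduction (f i)) hm hspan
  have hJ : ∀ i l, linearCoeff hr l (reduction (f i)) =
      hom (fieldFiltration k) (S i - R l) (jacobian f i l) := by
    intro i l
    rw [hred, linearCoeff_hom hr l (hle i)]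
    rfl
  have hJle : ∀ i l, jacobian f i l ∈ (fieldFiltration k).le (S i - R l) := fun i l =>
    slope_mem_le hr (hle i) l
  have hd : ∀ j i, ∃ (d : k) (hd : d ∈ (fieldFiltration k).le (R j - S i)),
      c j i (R j - S i) = Piece.mk _ _ d hd := by
    intro j i
    obtain ⟨d, hd, h, -⟩ := exists_of_eq_hom (c j i (R j - S i))
    exact ⟨d, hd, h.symm⟩
  choose d hd hdc using hd
  refine ⟨fun i => (supNorm (f i)).toReal, hs, Matrix.of d, fun i => (mem_le_iff hr).1 (hle i),
    fun i => ?_, fun j i => ?_, fun j l => ?_, fun i l => ?_⟩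
  · have h1 := mem_originIdeal.1 (hm i)
    rw [hred, augmentation_hom hr (hle i), hom_eq_zero (evalZero_mem_le hr _ _ (hle i))] at h1
    exact h1
  · have := mem_field_le.1 (hd j i)
    rwa [Degree.val_sub, le_div_iff₀ (S i).val_pos] at this
  · have h1 := congrFun (congrFun hcl j) l
    rw [Matrix.mul_apply, (hom_one_matrix (p := R) j l).2] at h1
    have h2 := norm_sum_sub_lt (α := fun i => S i - R l) (β := fun i => R j - S i)
      (fun i => sub_add_sub_cancel' _ _ _) (fun i => hJle i l) (hd j) (hdc j)
      (hom_one_matrix (p := R) j l).1 (by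
        rw [← h1]
        refine Finset.sum_congr rfl fun i _ => ?_
        rw [Matrix.of_apply, hJ, mul_comm])
    rw [Degree.val_sub, lt_div_iff₀ (R l).val_pos] at h2
    rw [Matrix.sub_apply, Matrix.mul_apply]
    simp only [Matrix.of_apply, mul_comm (d j _)]
    exact h2
  · have h1 := congrFun (congrFun hcr i) l
    rw [Matrix.mul_apply, (hom_one_matrix (p := S) i l).2] at h1
    have h2 := norm_sum_sub_lt (α := fun j => S i - R j) (β := fun j => R j - S l)
      (fun j => sub_add_sub_cancel _ _ _) (fun j => hJle i j) (fun j => hd j l) (fun j => hdc j l)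
      (hom_one_matrix (p := S) i l).1 (by
        rw [← h1]
        refine Finset.sum_congr rfl fun j _ => ?_
        rw [Matrix.of_apply, hJ])
    rw [Degree.val_sub, lt_div_iff₀ (S l).val_pos] at h2
    rw [Matrix.sub_apply, Matrix.mul_apply]
    exact h2

end Cotangent

end VirtualPolydisc

theorem proposition3p3 {k : Type*} [NormedField k] [IsUltrametricDist k] [CompleteSpace k]
    {n : ℕ} (r : Fin n → ℝ) (hr : ∀ i, 0 < r i)
    (f : Fin n → VirtualPolydisc.functions k r)
    (hf : ∀ i, VirtualPolydisc.supNorm (f i) < ⊤) :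
    (∃! m : Ideal (VirtualPolydisc.FunctionReduction k r),
      VirtualPolydisc.IsMaximalHomogeneousIdeal m) ∧
    ∀ m : Ideal (VirtualPolydisc.FunctionReduction k r),
      VirtualPolydisc.IsMaximalHomogeneousIdeal m →
      List.TFAE [
        VirtualPolydisc.IsCoordinateSystem f,
        (∀ i, VirtualPolydisc.reduction (f i) ∈ m) ∧
          Ideal.span (Set.range fun i => VirtualPolydisc.reduction (f i)) = m,
        ∃ hm : ∀ i, VirtualPolydisc.reduction (f i) ∈ m,
          LinearIndependent (VirtualPolydisc.GradedResidueField k)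
              (fun i => m.toCotangent ⟨VirtualPolydisc.reduction (f i), hm i⟩) ∧
            Submodule.span (VirtualPolydisc.GradedResidueField k)
              (Set.range fun i => m.toCotangent ⟨VirtualPolydisc.reduction (f i), hm i⟩) = ⊤] := by
  refine ⟨⟨VirtualPolydisc.originIdeal k hr, (VirtualPolydisc.isMaximalHomogeneousIdeal_iff hr).2 rfl,
    fun m hm => (VirtualPolydisc.isMaximalHomogeneousIdeal_iff hr).1 hm⟩, fun m hm => ?_⟩
  obtain rfl : m = VirtualPolydisc.originIdeal k hr :=
    (VirtualPolydisc.isMaximalHomogeneousIdeal_iff hr).1 hm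
  tfae_have 1 → 2 := fun h => h.span_reduction hr
  tfae_have 2 → 3 := fun h => ⟨h.1,
    VirtualPolydisc.linearIndependent_toCotangent (fun x => VirtualPolydisc.mem_originIdeal)
      (VirtualPolydisc.augmentation_algebraMap hr) (VirtualPolydisc.linearCoeff_mul hr)
      (VirtualPolydisc.linearCoeff_algebraMap hr) (VirtualPolydisc.hom_coordinate_mem hr)
      (VirtualPolydisc.linearCoeff_coordinate hr) _ h.1 h.2,
    VirtualPolydisc.span_toCotangent (fun x => VirtualPolydisc.mem_originIdeal)
      (VirtualPolydisc.augmentation_algebraMap hr) _ h.1 h.2⟩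
  tfae_have 3 → 1 := by
    rintro ⟨hm', hind, hspan⟩
    obtain ⟨s, hs, d, H⟩ := VirtualPolydisc.exists_isAlmostInverse hr hf hm' hind hspan
    exact H.isCoordinateSystem hr hs
  tfae_finish
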